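/- Let $A$ be a commutative ring with unit (the zero ring is allowed). Let $\mathrm{Spec}(A)$ be the locale of prime filters of $A$: its frame of opens is the Lindenbaum algebra of the propositional geometric theory with one atom $D(x)$ for each $x \in A$ and the axioms $D(0) \vdash \bot$, $D(x+y) \vdash D(x) \vee D(y)$, $D(xy) \vdash D(x)$, $\top \vdash D(1)$, $D(x) \wedge D(y) \vdash D(xy)$. For an $A$-module $M$ let $M^\sim = \underline{M}[\mathfrak{f}_0^{-1}]$ be the sheaf on $\mathrm{Spec}(A)$ obtained by localizing the constant sheaf $\underline{M}$ at the generic prime filter $\mathfrak{f}_0 \subseteq \underline{A}$, where $\mathfrak{f}_0(U)$ consists of the sections $s \in \underline{A}(U)$ such that for each $x \in A$ the part of $U$ on which $s = x$ is contained in $[D(x)]$. In particular $A^\sim$ is a sheaf of rings, and $M^\sim$ is a sheaf of $A^\sim$-modules. Let $f \in A$. A formula over $f$ is a (finitary) first-order formula, built from equality, $\top$, $\bot$, $\wedge$, $\vee$, $\Rightarrow$, $\forall$, $\exists$ and without free variables, over the signature that has a sort $M^\sim$ for each $A$-module $M$ (with the sort $A^\sim$ for $M = A$), function symbols for the ring structure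 of $A^\sim$ and the $A^\sim$-module structure of each $M^\sim$, a function symbol $M^\sim \to N^\sim$ for each $A$-linear map $M \to N$, and a constant of sort $M^\sim$ for each element of $M[f^{-1}]$ (in particular one of sort $A^\sim$ for each element of $A[f^{-1}]$). The sheaf semantics $U \models \varphi$, for opens $U \preceq [D(f)]$, is defined by recursion on $\varphi$ as follows; constants from $M[f^{-1}]$ denote their images under the canonical map $M[f^{-1}] \to M^\sim([D(f)])$, restricted to the open in question. - $U \models s =_{M^\sim} t$ iff $s = t$ in $M^\sim(U)$; $U \models \top$ always; $U \models \bot$ iff $U = \bot$. - $U \models \varphi \wedge \psi$ iff $U \models \varphi$ and $U \models \psi$. - $U \models \varphi \vee \psi$ iff there is an open covering $U = \bigvee_i U_i$ such that for each $i$, $U_i \models \varphi$ or $U_i \models \psi$. - $U \models \varphi \Rightarrow \psi$ iff for all opens $V \preceq U$, $V \models \varphi$ implies $V \models \psi$. - $U \models \forall x{:}M^\sim.\ \varphi(x)$ iff for all opens $V \preceq U$ and all $x_0 \in M^\sim(V)$, $V \models \varphi(x_0)$. - $U \models \exists x{:}M^\sim.\ \varphi(x)$ iff there is an open covering $U = \bigvee_i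 U_i$ such that for each $i$, $U_i \models \varphi(x_0)$ for some $x_0 \in M^\sim(U_i)$. The algebraic semantics $g \models \varphi$, for multiples $g$ of $f$, is defined by recursion on $\varphi$ as follows; constants from $M[f^{-1}]$ are mapped to $M[g^{-1}]$ by the canonical map, and a partition means an equation $g^n = g h_1 + \cdots + g h_m$ with $n, m \geq 0$ and $h_i \in A$. - $g \models s =_{M^\sim} t$ iff $s = t$ in $M[g^{-1}]$; $g \models \top$ always; $g \models \bot$ iff $g$ is nilpotent. - $g \models \varphi \wedge \psi$ iff $g \models \varphi$ and $g \models \psi$. - $g \models \varphi \vee \psi$ iff there is a partition $g^n = g h_1 + \cdots + g h_m$ such that for each $i$, $g h_i \models \varphi$ or $g h_i \models \psi$. - $g \models \varphi \Rightarrow \psi$ iff for all $h \in A$, $g h \models \varphi$ implies $g h \models \psi$. - $g \models \forall x{:}M^\sim.\ \varphi(x)$ iff for all $h \in A$ and all $x_0 \in M[(g h)^{-1}]$, $g h \models \varphi(x_0)$. - $g \models \exists x{:}M^\sim.\ \varphi(x)$ iff there is a partition $g^n = g h_1 + \cdots + g h_m$ such that for each $i$, $g h_i \models \varphi(x_0)$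 for some $x_0 \in M[(g h_i)^{-1}]$. Then for every $f \in A$ and every formula $\varphi$ over $f$: $[D(f)] \models \varphi$ in the sheaf semantics if and only if $f \models \varphi$ in the algebraic semantics. -/

import Mathlib

universe u v w

/-! ### Propositional geometric theories and their classifying locales -/

/-- Formulas of propositional geometric logic over a set `σ` of nullary relation symbols:
finite conjunctions and arbitrary set-indexed disjunctions. -/
inductive GeomFormula (σ : Type u) : Type (u + 1)
  | atom (x : σ) : GeomFormula σ
  | top : GeomFormula σ
  | and (φ ψ : GeomFormula σ) : GeomFormula σ
  | bot : GeomFormula σ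
  | or (φ ψ : GeomFormula σ) : GeomFormula σ
  | sup (ι : Type u) (φ : ι → GeomFormula σ) : GeomFormula σ

namespace GeomFormula

/-- A propositional geometric theory over the symbols `σ`: the set of its axioms `φ ⊢ ψ`. -/
abbrev Theory (σ : Type u) : Type (u + 1) := GeomFormula σ → GeomFormula σ → Prop

/-- `T.Proves φ ψ`: the sequent `φ ⊢ ψ` is derivable from the axioms of `T` by the (propositional)
rules of geometric logic. -/
inductive Theory.Proves {σ : Type u} (T : Theory σ) : GeomFormula σ → GeomFormula σ → Prop
  | ax {φ ψ} : T φ ψ → Proves T φ ψ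
  | refl (φ) : Proves T φ φ
  | trans {φ ψ χ} : Proves T φ ψ → Proves T ψ χ → Proves T φ χ
  | top (φ) : Proves T φ top
  | and_left (φ ψ) : Proves T (and φ ψ) φ
  | and_right (φ ψ) : Proves T (and φ ψ) ψ
  | and_intro {φ ψ χ} : Proves T φ ψ → Proves T φ χ → Proves T φ (and ψ χ)
  | bot (φ) : Proves T bot φ
  | or_left (φ ψ) : Proves T φ (or φ ψ)
  | or_right (φ ψ) : Proves T ψ (or φ ψ)
  | or_elim {φ ψ χ} : Proves T φ χ → Proves T ψ χ → Proves T (or φ ψ) χ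
  | sup_intro {ι : Type u} (φ : ι → GeomFormula σ) (i : ι) : Proves T (φ i) (sup ι φ)
  | sup_elim {ι : Type u} {φ : ι → GeomFormula σ} {χ} :
      (∀ i, Proves T (φ i) χ) → Proves T (sup ι φ) χ
  | distrib {ι : Type u} (φ : ι → GeomFormula σ) (ψ) :
      Proves T (and (sup ι φ) ψ) (sup ι fun i => and (φ i) ψ)

/-- The conjunction of a finite list of atoms. -/
def conj {σ : Type u} : List σ → GeomFormula σ
  | [] => top
  | x :: l => and (atom x) (conj l)

variable {σ : Type u} (T : Theory σ)

theorem Theory.proves_conj_append (l l' : List σ) :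
    T.Proves (and (conj l) (conj l')) (conj (l ++ l')) := by
  induction l with
  | nil => exact .and_right _ _
  | cons x l ih =>
    refine .and_intro (.trans (.and_left _ _) (.and_left _ _)) (.trans (.and_intro ?_ ?_) ih)
    · exact .trans (.and_left _ _) (.and_right _ _)
    · exact .and_right _ _

theorem Theory.conj_append_proves (l l' : List σ) :
    T.Proves (conj (l ++ l')) (and (conj l) (conj l')) := by
  induction l with
  | nil => exact .and_intro (.top _) (.refl _)
  | cons x l ih =>
    refine .and_intro (.and_intro (.and_left _ _) ?_) ?_
    · exact .trans (.and_right _ _) (.trans ih (.and_left _ _))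
    · exact .trans (.and_right _ _) (.trans ih (.and_right _ _))

/-- Every geometric formula is provably a set-indexed disjunction of finite conjunctions. -/
theorem Theory.normalForm (φ : GeomFormula σ) :
    T.Proves φ (sup {l : List σ // T.Proves (conj l) φ} fun l => conj l.1) := by
  have key : ∀ (ψ χ : GeomFormula σ), T.Proves ψ χ →
      T.Proves (sup {l : List σ // T.Proves (conj l) ψ} fun l => conj l.1)
        (sup {l : List σ // T.Proves (conj l) χ} fun l => conj l.1) := fun ψ χ h =>
    .sup_elim fun l => .sup_intro (ι := {l : List σ // T.Proves (conj l) χ})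
      (fun l => conj l.1) ⟨l.1, l.2.trans h⟩
  induction φ with
  | atom x =>
    exact .trans (.and_intro (.refl _) (.top _))
      (.sup_intro (ι := {l : List σ // T.Proves (conj l) (atom x)})
        (fun l => conj l.1) ⟨[x], .and_left _ _⟩)
  | top =>
    exact .sup_intro (ι := {l : List σ // T.Proves (conj l) top})
        (fun l => conj l.1) ⟨[], .refl _⟩
  | and φ ψ ih₁ ih₂ =>
    have e : ∀ l l' : List σ, T.Proves (conj l) φ → T.Proves (conj l') ψ →
        T.Proves (and (conj l') (conj l))
          (sup {l : List σ // T.Proves (conj l) (and φ ψ)} fun l => conj l.1) := by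
      intro l l' h h'
      refine .trans (T.proves_conj_append _ _)
        (.sup_intro (ι := {l : List σ // T.Proves (conj l) (and φ ψ)})
          (fun l => conj l.1) ⟨l' ++ l, .trans (T.conj_append_proves _ _) ?_⟩)
      exact .and_intro (.trans (.and_right _ _) h) (.trans (.and_left _ _) h')
    refine .trans (.and_intro (.trans (.and_left _ _) ih₁) (.and_right _ _)) ?_
    refine .trans (.distrib _ _) (.sup_elim fun l => ?_)
    refine .trans (.and_intro (.trans (.and_right _ _) ih₂) (.and_left _ _)) ?_
    exact .trans (.distrib _ _) (.sup_elim fun l' => e _ _ l.2 l'.2)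
  | bot => exact .bot _
  | or φ ψ ih₁ ih₂ =>
    exact .or_elim (ih₁.trans (key _ _ (.or_left _ _))) (ih₂.trans (key _ _ (.or_right _ _)))
  | sup ι φ ih =>
    exact .sup_elim fun i => (ih i).trans (key _ _ (.sup_intro φ i))

/-- The preorder of geometric formulas given by provable entailment. -/
def Theory.setoid : Setoid (GeomFormula σ) where
  r φ ψ := T.Proves φ ψ ∧ T.Proves ψ φ
  iseqv := ⟨fun φ => ⟨.refl φ, .refl φ⟩, fun h => ⟨h.2, h.1⟩,
    fun h h' => ⟨h.1.trans h'.1, h'.2.trans h.2⟩⟩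

/-- The Lindenbaum algebra of a propositional geometric theory: geometric formulas modulo provable
equivalence. It is the frame of opens of the classifying locale of the theory. -/
def Theory.Lindenbaum : Type (u + 1) := Quotient T.setoid

namespace Theory.Lindenbaum

variable {T}

/-- The class `[φ]` of a geometric formula. -/
def mk (φ : GeomFormula σ) : T.Lindenbaum := Quotient.mk T.setoid φ

theorem mk_surjective (a : T.Lindenbaum) : ∃ φ, mk φ = a := Quotient.exists_rep a

instance : LE T.Lindenbaum where
  le := Quotient.lift₂ (fun φ ψ => T.Proves φ ψ) fun _ _ _ _ h h' =>
    propext ⟨fun e => h.2.trans (e.trans h'.1), fun e => h.1.trans (e.trans h'.2)⟩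

theorem mk_le_mk {φ ψ : GeomFormula σ} : (mk φ : T.Lindenbaum) ≤ mk ψ ↔ T.Proves φ ψ := Iff.rfl

instance : PartialOrder T.Lindenbaum where
  le_refl a := by
    obtain ⟨φ, rfl⟩ := mk_surjective a
    exact .refl φ
  le_trans a b c := by
    obtain ⟨φ, rfl⟩ := mk_surjective a
    obtain ⟨ψ, rfl⟩ := mk_surjective b
    obtain ⟨χ, rfl⟩ := mk_surjective c
    exact fun h h' => Proves.trans h h'
  le_antisymm a b := by
    obtain ⟨φ, rfl⟩ := mk_surjective a
    obtain ⟨ψ, rfl⟩ := mk_surjective b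
    exact fun h h' => Quotient.sound ⟨h, h'⟩

instance : SemilatticeInf T.Lindenbaum where
  inf := Quotient.map₂ and fun _ _ h _ _ h' =>
    ⟨.and_intro ((Proves.and_left _ _).trans h.1) ((Proves.and_right _ _).trans h'.1),
      .and_intro ((Proves.and_left _ _).trans h.2) ((Proves.and_right _ _).trans h'.2)⟩
  inf_le_left a b := by
    obtain ⟨φ, rfl⟩ := mk_surjective a
    obtain ⟨ψ, rfl⟩ := mk_surjective b
    exact Proves.and_left _ _
  inf_le_right a b := by
    obtain ⟨φ, rfl⟩ := mk_surjective a
    obtain ⟨ψ, rfl⟩ := mk_surjective b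
    exact Proves.and_right _ _
  le_inf a b c := by
    obtain ⟨φ, rfl⟩ := mk_surjective a
    obtain ⟨ψ, rfl⟩ := mk_surjective b
    obtain ⟨χ, rfl⟩ := mk_surjective c
    exact fun h h' => Proves.and_intro h h'

/-- The join of an arbitrary set of classes, as the disjunction of the finite conjunctions of atoms
that entail some member of the set. -/
instance : SupSet T.Lindenbaum where
  sSup S := mk (sup {l : List σ // ∃ a ∈ S, mk (conj l) ≤ a} fun l => conj l.1)

theorem isLUB_sSup (S : Set T.Lindenbaum) : IsLUB S (sSup S) := by
  refine ⟨fun a ha => ?_, fun b hb => ?_⟩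
  · obtain ⟨φ, rfl⟩ := mk_surjective a
    refine (T.normalForm φ).trans (.sup_elim fun l => ?_)
    exact .sup_intro (ι := {l : List σ // ∃ a ∈ S, mk (conj l) ≤ a}) (fun l => conj l.1)
      ⟨l.1, mk φ, ha, l.2⟩
  · obtain ⟨χ, rfl⟩ := mk_surjective b
    refine Proves.sup_elim fun l => ?_
    obtain ⟨a, ha, hl⟩ := l.2
    exact mk_le_mk.1 (hl.trans (hb ha))

instance : CompleteLattice T.Lindenbaum :=
  { completeLatticeOfSup T.Lindenbaum isLUB_sSup with
    inf := fun a b => a ⊓ b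
    inf_le_left := fun _ _ => inf_le_left
    inf_le_right := fun _ _ => inf_le_right
    le_inf := fun _ _ _ => le_inf }

theorem mk_and (φ ψ : GeomFormula σ) : (mk (and φ ψ) : T.Lindenbaum) = mk φ ⊓ mk ψ := rfl

theorem mk_sup {ι : Type u} (φ : ι → GeomFormula σ) :
    (mk (sup ι φ) : T.Lindenbaum) = ⨆ i, mk (φ i) := by
  refine le_antisymm ?_ (iSup_le fun i => Proves.sup_intro φ i)
  obtain ⟨χ, hχ⟩ := mk_surjective (⨆ i, (mk (φ i) : T.Lindenbaum))
  rw [← hχ, mk_le_mk]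
  refine Proves.sup_elim fun i => ?_
  rw [← mk_le_mk, hχ]
  exact le_iSup (fun i => (mk (φ i) : T.Lindenbaum)) i

theorem mk_top : (mk top : T.Lindenbaum) = ⊤ := by
  refine top_le_iff.1 ?_
  obtain ⟨φ, hφ⟩ := mk_surjective (⊤ : T.Lindenbaum)
  rw [← hφ]
  exact Proves.top φ

theorem mk_bot : (mk bot : T.Lindenbaum) = ⊥ := by
  refine le_bot_iff.1 ?_
  obtain ⟨φ, hφ⟩ := mk_surjective (⊥ : T.Lindenbaum)
  rw [← hφ]
  exact Proves.bot φ

theorem mk_or (φ ψ : GeomFormula σ) : (mk (or φ ψ) : T.Lindenbaum) = mk φ ⊔ mk ψ := by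
  refine le_antisymm ?_ (sup_le (Proves.or_left φ ψ) (Proves.or_right φ ψ))
  obtain ⟨χ, hχ⟩ := mk_surjective (mk φ ⊔ mk ψ : T.Lindenbaum)
  rw [← hχ, mk_le_mk]
  refine Proves.or_elim ?_ ?_ <;> rw [← mk_le_mk, hχ]
  exacts [le_sup_left, le_sup_right]

instance : Order.Frame T.Lindenbaum := Order.Frame.ofMinimalAxioms
  { inf_sSup_le_iSup_inf := fun a S => by
      obtain ⟨ψ, rfl⟩ := mk_surjective a
      have h : (mk ψ ⊓ sSup S : T.Lindenbaum) ≤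
          mk (sup {l : List σ // ∃ a ∈ S, mk (T := T) (conj l) ≤ a}
            fun l => and (conj l.1) ψ) := by
        rw [inf_comm]
        exact Proves.distrib _ _
      refine h.trans ?_
      rw [mk_sup]
      refine iSup_le fun l => ?_
      obtain ⟨a, ha, hl⟩ := l.2
      refine le_trans ?_ (le_iSup₂ (f := fun b _ => mk ψ ⊓ b) a ha)
      rw [mk_and, inf_comm]
      exact inf_le_inf le_rfl hl }

end Theory.Lindenbaum

end GeomFormula

/-! ### The spectrum of a ring -/

open GeomFormula in
/-- The axioms of the theory of prime filters of a ring `A`; the atom `x` is read `D(x)`. -/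
inductive primeFilterTheory (A : Type u) [CommRing A] : GeomFormula A → GeomFormula A → Prop
  | zero : primeFilterTheory A (atom 0) bot
  | add (x y : A) : primeFilterTheory A (atom (x + y)) (or (atom x) (atom y))
  | of_mul (x y : A) : primeFilterTheory A (atom (x * y)) (atom x)
  | one : primeFilterTheory A top (atom 1)
  | mul (x y : A) : primeFilterTheory A (and (atom x) (atom y)) (atom (x * y))

/-- The frame of opens of `Spec(A)`, the classifying locale of the theory of prime filters. -/
abbrev LocaleSpec (A : Type u) [CommRing A] : Type (u + 1) :=
  GeomFormula.Theory.Lindenbaum (primeFilterTheory A)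

namespace LocaleSpec

variable {A : Type u} [CommRing A]

/-- The basic open `[D(x)]`. -/
def D (x : A) : LocaleSpec A := GeomFormula.Theory.Lindenbaum.mk (GeomFormula.atom x)

theorem D_one : D (1 : A) = ⊤ :=
  top_le_iff.1 ((GeomFormula.Theory.Lindenbaum.mk_top).symm.le.trans
    (GeomFormula.Theory.Proves.ax (.one)))

theorem D_mul_le_left (x y : A) : D (x * y) ≤ D x := GeomFormula.Theory.Proves.ax (.of_mul x y)

theorem D_inf_le_mul (x y : A) : D x ⊓ D y ≤ D (x * y) :=
  GeomFormula.Theory.Proves.ax (.mul x y)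

end LocaleSpec

/-! ### Presheaves and sheaves on a locale -/

/-- A presheaf of sets on the locale with frame of opens `X`. -/
structure LocalePresheaf (X : Type v) [Order.Frame X] where
  obj : X → Type w
  res : ∀ {V U : X}, V ≤ U → obj U → obj V
  res_id : ∀ {U : X} (x : obj U), res le_rfl x = x
  res_res : ∀ {W V U : X} (h : W ≤ V) (h' : V ≤ U) (x : obj U),
    res h (res h' x) = res (h.trans h') x

namespace LocalePresheaf

variable {X : Type v} [Order.Frame X]

/-- The sheaf condition: sections over an open covering that agree on overlaps glue uniquely. -/
def IsSheaf (P : LocalePresheaf.{v, w} X) : Prop :=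
  ∀ (ι : Type v) (U : X) (V : ι → X) (hV : ∀ i, V i ≤ U), U = ⨆ i, V i →
    ∀ s : ∀ i, P.obj (V i),
      (∀ i j, P.res (inf_le_left : V i ⊓ V j ≤ V i) (s i) =
        P.res (inf_le_right : V i ⊓ V j ≤ V j) (s j)) →
      ∃! t : P.obj U, ∀ i, P.res (hV i) t = s i

/-- `Locally U p`: the open `U` is covered by opens `V ≤ U` on which `p` holds. -/
def Locally (U : X) (p : ∀ V : X, V ≤ U → Prop) : Prop := U ≤ sSup {V | ∃ h : V ≤ U, p V h}

theorem Locally.of {U : X} {p : ∀ V : X, V ≤ U → Prop} (h : p U le_rfl) : Locally U p :=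
  le_sSup ⟨le_rfl, h⟩

theorem Locally.mono {U : X} {p q : ∀ V : X, V ≤ U → Prop} (hp : Locally U p)
    (h : ∀ V hV, p V hV → q V hV) : Locally U q :=
  hp.trans (sSup_le_sSup fun _ ⟨hV, e⟩ => ⟨hV, h _ hV e⟩)

/-- If `U` is covered by opens `V ≤ U` for which `q` holds locally on `V`, then `q` holds locally
on `U`. -/
theorem Locally.bind {U : X} {p q : ∀ V : X, V ≤ U → Prop} (hp : Locally U p)
    (h : ∀ V (hV : V ≤ U), p V hV → Locally V fun W hW => q W (hW.trans hV)) : Locally U q :=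
  hp.trans (sSup_le fun V ⟨hV, e⟩ =>
    (h V hV e).trans (sSup_le_sSup fun _ ⟨hW, e'⟩ => ⟨hW.trans hV, e'⟩))

theorem Locally.restrict {U V : X} {p : ∀ V : X, V ≤ U → Prop} (hp : Locally U p) (hV : V ≤ U)
    (hres : ∀ (W W' : X) (hW : W ≤ U) (hW' : W' ≤ W), p W hW → p W' (hW'.trans hW)) :
    Locally V fun W hW => p W (hW.trans hV) := by
  have h : V ≤ V ⊓ sSup {W | ∃ h : W ≤ U, p W h} := le_inf le_rfl (hV.trans hp)
  rw [inf_sSup_eq] at h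
  refine h.trans (iSup₂_le fun W ⟨hW, e⟩ => le_sSup ⟨inf_le_left, ?_⟩)
  exact hres W _ hW inf_le_right e

theorem Locally.and {U : X} {p q : ∀ V : X, V ≤ U → Prop} (hp : Locally U p) (hq : Locally U q)
    (hpres : ∀ (W W' : X) (hW : W ≤ U) (hW' : W' ≤ W), p W hW → p W' (hW'.trans hW))
    (hqres : ∀ (W W' : X) (hW : W ≤ U) (hW' : W' ≤ W), q W hW → q W' (hW'.trans hW)) :
    Locally U fun V hV => p V hV ∧ q V hV :=
  hp.bind fun V hV e => (hq.restrict hV hqres).mono fun W hW e' => ⟨hpres V W hV hW e, e'⟩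

/-- A section over `U` of the sheafification of the presheaf `P`: a subpresheaf of `P` on the opens
below `U` whose sections (those to which the new section restricts) locally exist, are locally
unique, and form a family closed under gluing. -/
@[ext]
structure ShSection (P : LocalePresheaf.{v, w} X) (U : X) where
  /-- the sections of `P` over `V` that represent the restriction to `V` -/
  carrier : ∀ V : X, Set (P.obj V)
  le : ∀ {V : X} {x : P.obj V}, x ∈ carrier V → V ≤ U
  res_mem : ∀ {W V : X} (h : W ≤ V) {x : P.obj V}, x ∈ carrier V → P.res h x ∈ carrier W
  locally_exists : Locally U fun V _ => (carrier V).Nonempty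
  locally_eq : ∀ {V : X} {x y : P.obj V}, x ∈ carrier V → y ∈ carrier V →
    Locally V fun _ h => P.res h x = P.res h y
  local_mem : ∀ {V : X} {x : P.obj V}, (Locally V fun W h => P.res h x ∈ carrier W) →
    x ∈ carrier V

namespace ShSection

variable {P : LocalePresheaf.{v, w} X} {U V : X}

theorem ext_of_le {σ τ : ShSection P U} (h : ∀ V, σ.carrier V ⊆ τ.carrier V) : σ = τ := by
  refine ShSection.ext (funext fun V => (h V).antisymm fun x hx => ?_)
  refine σ.local_mem ((σ.locally_exists.restrict (τ.le hx) ?_).bind fun W hW e => ?_)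
  · exact fun W W' _ hW' ⟨y, hy⟩ => ⟨_, σ.res_mem hW' hy⟩
  · obtain ⟨y, hy⟩ := e
    refine (τ.locally_eq (τ.res_mem hW hx) (h W hy)).mono fun W' hW' e => ?_
    rw [P.res_res] at e
    rw [e]
    exact σ.res_mem hW' hy

/-- Two sections agree as soon as they locally have a common representative. -/
theorem ext_of_locally {σ τ : ShSection P U}
    (h : Locally U fun V _ => ∃ x, x ∈ σ.carrier V ∧ x ∈ τ.carrier V) : σ = τ := by
  refine ext_of_le fun V y hy => τ.local_mem ((h.restrict (σ.le hy) ?_).bind fun W hW e => ?_)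
  · exact fun W W' _ hW' ⟨y, hy, hy'⟩ => ⟨_, σ.res_mem hW' hy, τ.res_mem hW' hy'⟩
  · obtain ⟨x, hx, hx'⟩ := e
    refine (σ.locally_eq (σ.res_mem hW hy) hx).mono fun W' hW' e => ?_
    rw [P.res_res] at e
    rw [e]
    exact τ.res_mem hW' hx'

/-- The section given by a locally inhabited and locally unique family `K` of sections of `P`. -/
def glue (K : ∀ V : X, Set (P.obj V)) (le : ∀ {V : X} {x : P.obj V}, x ∈ K V → V ≤ U)
    (res_mem : ∀ {W V : X} (h : W ≤ V) {x : P.obj V}, x ∈ K V → P.res h x ∈ K W)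
    (locally_exists : Locally U fun V _ => (K V).Nonempty)
    (locally_eq : ∀ {V : X} {x y : P.obj V}, x ∈ K V → y ∈ K V →
      Locally V fun _ h => P.res h x = P.res h y) : ShSection P U where
  carrier V := {x | Locally V fun W h => P.res h x ∈ K W}
  le {V x} hx := hx.trans (sSup_le fun W ⟨_, h⟩ => le h)
  res_mem {W V} h x hx := by
    refine (Locally.restrict hx h ?_).mono fun W' hW' e => ?_
    · intro W W' hW hW' e
      rw [← P.res_res hW' hW]
      exact res_mem hW' e
    · rwa [P.res_res]
  locally_exists := locally_exists.mono fun V _ ⟨x, hx⟩ =>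
    ⟨x, Locally.of (by rwa [P.res_id])⟩
  locally_eq {V x y} hx hy := by
    refine (Locally.and hx hy ?_ ?_).bind fun W hW e => ?_
    · intro W W' hW hW' e
      rw [← P.res_res hW' hW]
      exact res_mem hW' e
    · intro W W' hW hW' e
      rw [← P.res_res hW' hW]
      exact res_mem hW' e
    · refine (locally_eq e.1 e.2).mono fun W' hW' e => ?_
      rwa [P.res_res, P.res_res] at e
  local_mem {V x} hx := by
    refine Locally.bind hx fun W hW e => Locally.mono e fun W' hW' e => ?_
    rwa [P.res_res] at e

theorem mem_glue {K : ∀ V : X, Set (P.obj V)} {le res_mem locally_exists locally_eq}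
    {x : P.obj V} (hx : x ∈ K V) :
    x ∈ (glue (U := U) K le res_mem locally_exists locally_eq).carrier V :=
  Locally.of (by rwa [P.res_id])

/-- Restriction of sections of the sheafification. -/
def res (h : V ≤ U) (σ : ShSection P U) : ShSection P V where
  carrier W := {x | x ∈ σ.carrier W ∧ W ≤ V}
  le hx := hx.2
  res_mem h' _ hx := ⟨σ.res_mem h' hx.1, h'.trans hx.2⟩
  locally_exists := by
    refine (σ.locally_exists.restrict h ?_).mono fun W hW ⟨x, hx⟩ => ⟨x, hx, hW⟩
    exact fun W W' _ hW' ⟨y, hy⟩ => ⟨_, σ.res_mem hW' hy⟩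
  locally_eq hx hy := σ.locally_eq hx.1 hy.1
  local_mem hx := ⟨σ.local_mem (hx.mono fun _ _ e => e.1), hx.trans (sSup_le fun _ ⟨_, e⟩ => e.2)⟩

/-- The section of the sheafification given by a section of `P`. -/
def unit (x : P.obj U) : ShSection P U :=
  glue (fun V => {y | ∃ h : V ≤ U, y = P.res h x}) (fun ⟨h, _⟩ => h)
    (by
      rintro W V h y ⟨h', rfl⟩
      exact ⟨h.trans h', P.res_res _ _ _⟩)
    (Locally.of ⟨_, le_rfl, rfl⟩)
    (by
      rintro V y z ⟨h, rfl⟩ ⟨_, rfl⟩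
      exact Locally.of rfl)

theorem res_mem_unit (x : P.obj U) (h : V ≤ U) : P.res h x ∈ (unit x).carrier V :=
  mem_glue ⟨h, rfl⟩

theorem mem_unit (x : P.obj U) : x ∈ (unit x).carrier U := by
  simpa [P.res_id] using res_mem_unit x le_rfl

/-- The action on sections of a natural map of presheaves. -/
def map {Q : LocalePresheaf.{v, w} X} (f : ∀ V, P.obj V → Q.obj V)
    (hf : ∀ {W V : X} (h : W ≤ V) (x : P.obj V), Q.res h (f V x) = f W (P.res h x))
    (σ : ShSection P U) : ShSection Q U :=
  glue (fun V => f V '' σ.carrier V) (by rintro V _ ⟨x, hx, rfl⟩; exact σ.le hx)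
    (by
      rintro W V h _ ⟨x, hx, rfl⟩
      exact ⟨_, σ.res_mem h hx, (hf h x).symm⟩)
    (σ.locally_exists.mono fun V _ ⟨x, hx⟩ => ⟨_, x, hx, rfl⟩)
    (by
      rintro V _ _ ⟨x, hx, rfl⟩ ⟨y, hy, rfl⟩
      exact (σ.locally_eq hx hy).mono fun W hW e => by rw [hf, hf, e])

theorem mem_map {Q : LocalePresheaf.{v, w} X} {f : ∀ V, P.obj V → Q.obj V}
    {hf : ∀ {W V : X} (h : W ≤ V) (x : P.obj V), Q.res h (f V x) = f W (P.res h x)}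
    {σ : ShSection P U} {x : P.obj V} (hx : x ∈ σ.carrier V) : f V x ∈ (map f hf σ).carrier V :=
  mem_glue ⟨x, hx, rfl⟩

/-- The action on sections of a natural binary operation of presheaves. -/
def map₂ {Q R : LocalePresheaf.{v, w} X} (f : ∀ V, P.obj V → Q.obj V → R.obj V)
    (hf : ∀ {W V : X} (h : W ≤ V) (x : P.obj V) (y : Q.obj V),
      R.res h (f V x y) = f W (P.res h x) (Q.res h y))
    (σ : ShSection P U) (τ : ShSection Q U) : ShSection R U :=
  glue (fun V => Set.image2 (f V) (σ.carrier V) (τ.carrier V))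
    (by rintro V _ ⟨x, hx, y, hy, rfl⟩; exact σ.le hx)
    (by
      rintro W V h _ ⟨x, hx, y, hy, rfl⟩
      exact ⟨_, σ.res_mem h hx, _, τ.res_mem h hy, (hf h x y).symm⟩)
    ((σ.locally_exists.and τ.locally_exists
      (fun W W' _ hW' ⟨y, hy⟩ => ⟨_, σ.res_mem hW' hy⟩)
      (fun W W' _ hW' ⟨y, hy⟩ => ⟨_, τ.res_mem hW' hy⟩)).mono
        fun V _ ⟨⟨x, hx⟩, ⟨y, hy⟩⟩ => ⟨_, x, hx, y, hy, rfl⟩)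
    (by
      rintro V _ _ ⟨x, hx, y, hy, rfl⟩ ⟨x', hx', y', hy', rfl⟩
      refine ((σ.locally_eq hx hx').and (τ.locally_eq hy hy') ?_ ?_).mono fun W hW e => ?_
      · intro W W' hW hW' e
        rw [← P.res_res hW' hW, ← P.res_res hW' hW, e]
      · intro W W' hW hW' e
        rw [← Q.res_res hW' hW, ← Q.res_res hW' hW, e]
      · rw [hf, hf, e.1, e.2])

theorem mem_map₂ {Q R : LocalePresheaf.{v, w} X} {f : ∀ V, P.obj V → Q.obj V → R.obj V}
    {hf : ∀ {W V : X} (h : W ≤ V) (x : P.obj V) (y : Q.obj V),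
      R.res h (f V x y) = f W (P.res h x) (Q.res h y)}
    {σ : ShSection P U} {τ : ShSection Q U} {x : P.obj V} {y : Q.obj V}
    (hx : x ∈ σ.carrier V) (hy : y ∈ τ.carrier V) : f V x y ∈ (map₂ f hf σ τ).carrier V :=
  mem_glue ⟨x, hx, y, hy, rfl⟩

end ShSection

/-- The sheafification of a presheaf on a locale. -/
def sheafify (P : LocalePresheaf.{v, w} X) : LocalePresheaf X where
  obj U := ShSection P U
  res h σ := σ.res h
  res_id _ := ShSection.ext_of_le fun _ _ hx => hx.1
  res_res _ _ _ := ShSection.ext_of_le fun _ _ hx => ⟨hx.1.1, hx.2⟩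

theorem sheafify_isSheaf (P : LocalePresheaf.{v, w} X) : P.sheafify.IsSheaf := by
  intro ι U V hV hU s hs
  have hs' : ∀ i j W (x : P.obj W), x ∈ (s i).carrier W → W ≤ V j → x ∈ (s j).carrier W := by
    intro i j W x hx hj
    have h : x ∈ ((s i).res (inf_le_left : V i ⊓ V j ≤ V i)).carrier W :=
      ⟨hx, le_inf ((s i).le hx) hj⟩
    have e : (s i).res (inf_le_left : V i ⊓ V j ≤ V i) = (s j).res inf_le_right := hs i j
    rw [e] at h
    exact h.1
  let t : ShSection P U := ShSection.glue (fun W => {x | ∃ i, x ∈ (s i).carrier W})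
    (fun ⟨i, h⟩ => ((s i).le h).trans (hV i))
    (fun h _ ⟨i, hx⟩ => ⟨i, (s i).res_mem h hx⟩)
    (by
      have h : Locally U fun W _ => ∃ i, W = V i :=
        hU.le.trans (iSup_le fun i => le_sSup ⟨hV i, i, rfl⟩)
      refine h.bind fun W hW ⟨i, e⟩ => ?_
      subst e
      exact (s i).locally_exists.mono fun W' _ ⟨x, hx⟩ => ⟨x, i, hx⟩)
    (fun {W x y} ⟨i, hx⟩ ⟨j, hy⟩ =>
      (s i).locally_eq hx (hs' j i W y hy ((s i).le hx)))
  refine ⟨t, fun i => ?_, fun t' ht' => ?_⟩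
  · refine (ShSection.ext_of_le fun W x hx => ?_).symm
    exact ⟨ShSection.mem_glue ⟨i, hx⟩, (s i).le hx⟩
  · refine (ShSection.ext_of_le fun W x hx => ?_).symm
    refine t'.local_mem (Locally.mono hx fun W' hW' ⟨i, e⟩ => ?_)
    have h : (s i) = t'.res (hV i) := (ht' i).symm
    rw [h] at e
    exact e.1

/-- The presheaf all of whose restriction maps are the identity of the set `M`. -/
abbrev const (X : Type v) [Order.Frame X] (M : Type w) : LocalePresheaf.{v, w} X where
  obj _ := M
  res _ x := x
  res_id _ := rfl
  res_res _ _ _ := rfl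

end LocalePresheaf

open LocalePresheaf

/-- The sections over `U` of the constant sheaf associated to `M`. -/
abbrev ConstSection {X : Type v} [Order.Frame X] (M : Type w) (U : X) : Type (max v w) :=
  ShSection (LocalePresheaf.const X M) U

namespace ConstSection

section

variable {X : Type v} [Order.Frame X] {U V : X} {A : Type u} [CommRing A]
variable {M : Type u} [AddCommGroup M] [Module A M]

/-- `s.EqOn V x`: the open `V` is contained in `U`, and the section `s` over `U` restricts to the
constant `x` on `V`. -/
def EqOn {M : Type u} (s : ConstSection M U) (V : X) (x : M) : Prop := x ∈ s.carrier V

/-- The constant section with value `x`. -/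
def of {M : Type u} (U : X) (x : M) : ConstSection M U :=
  ShSection.unit (P := LocalePresheaf.const X M) x

instance : Zero (ConstSection M U) := ⟨of U 0⟩
instance : One (ConstSection A U) := ⟨of U 1⟩
instance : Add (ConstSection M U) :=
  ⟨ShSection.map₂ (fun _ (x y : M) => x + y) fun _ _ _ => rfl⟩
instance : Neg (ConstSection M U) := ⟨ShSection.map (fun _ (x : M) => -x) fun _ _ => rfl⟩
instance : Mul (ConstSection A U) :=
  ⟨ShSection.map₂ (fun _ (x y : A) => x * y) fun _ _ _ => rfl⟩
instance : SMul (ConstSection A U) (ConstSection M U) :=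
  ⟨ShSection.map₂ (fun _ (x : A) (y : M) => x • y) fun _ _ _ => rfl⟩

theorem eqOn_of {M : Type u} (x : M) (h : V ≤ U) : (of U x).EqOn V x :=
  ShSection.res_mem_unit (P := LocalePresheaf.const X M) x h

theorem EqOn.zero (h : V ≤ U) : (0 : ConstSection M U).EqOn V 0 := eqOn_of 0 h

theorem EqOn.one (h : V ≤ U) : (1 : ConstSection A U).EqOn V 1 := eqOn_of 1 h

theorem EqOn.add {s t : ConstSection M U} {x y : M} (hx : s.EqOn V x) (hy : t.EqOn V y) :
    (s + t).EqOn V (x + y) := ShSection.mem_map₂ (hf := fun _ _ _ => rfl) hx hy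

theorem EqOn.neg {s : ConstSection M U} {x : M} (hx : s.EqOn V x) : (-s).EqOn V (-x) :=
  ShSection.mem_map (hf := fun _ _ => rfl) hx

theorem EqOn.mul {s t : ConstSection A U} {x y : A} (hx : s.EqOn V x) (hy : t.EqOn V y) :
    (s * t).EqOn V (x * y) := ShSection.mem_map₂ (hf := fun _ _ _ => rfl) hx hy

theorem EqOn.smul {s : ConstSection A U} {t : ConstSection M U} {x : A} {y : M}
    (hx : s.EqOn V x) (hy : t.EqOn V y) : (s • t).EqOn V (x • y) :=
  ShSection.mem_map₂ (hf := fun _ _ _ => rfl) hx hy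

theorem EqOn.anti {M : Type u} {s : ConstSection M U} {W : X} {x : M} (hx : s.EqOn V x)
    (h : W ≤ V) : s.EqOn W x := s.res_mem h hx

theorem EqOn.res {M : Type u} {s : ConstSection M U} {W : X} {x : M} (hx : s.EqOn W x)
    (h : V ≤ U) (hW : W ≤ V) : ConstSection.EqOn (s.res h) W x := ⟨hx, hW⟩

theorem EqOn.of_res {M : Type u} {s : ConstSection M U} {W : X} {x : M} {h : V ≤ U}
    (hx : ConstSection.EqOn (s.res h) W x) : s.EqOn W x := hx.1

/-- Two values of a section on `V` agree unless `V` is empty. -/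
theorem EqOn.locally_eq {M : Type u} {s : ConstSection M U} {x y : M} (hx : s.EqOn V x)
    (hy : s.EqOn V y) : Locally V fun _ _ => x = y := ShSection.locally_eq s hx hy

theorem ext_of_locally {M : Type u} {s t : ConstSection M U}
    (h : Locally U fun V _ => ∃ x, s.EqOn V x ∧ t.EqOn V x) : s = t :=
  ShSection.ext_of_locally h

theorem locally₁ {M : Type u} (s : ConstSection M U) : Locally U fun V _ => ∃ x, s.EqOn V x :=
  s.locally_exists

theorem locally₂ {M N : Type u} (s : ConstSection M U) (t : ConstSection N U) :
    Locally U fun V _ => (∃ x, s.EqOn V x) ∧ ∃ x, t.EqOn V x :=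
  Locally.and s.locally₁ t.locally₁ (fun _ _ _ h ⟨_, hy⟩ => ⟨_, hy.anti h⟩)
    (fun _ _ _ h ⟨_, hy⟩ => ⟨_, hy.anti h⟩)

theorem locally₃ {L M N : Type u} (r : ConstSection L U) (s : ConstSection M U)
    (t : ConstSection N U) :
    Locally U fun V _ => (∃ x, r.EqOn V x) ∧ (∃ x, s.EqOn V x) ∧ ∃ x, t.EqOn V x :=
  Locally.and r.locally₁ (locally₂ s t) (fun _ _ _ h ⟨_, hy⟩ => ⟨_, hy.anti h⟩)
    (fun _ _ _ h ⟨⟨_, hx⟩, ⟨_, hy⟩⟩ => ⟨⟨_, hx.anti h⟩, ⟨_, hy.anti h⟩⟩)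

instance : AddCommGroup (ConstSection M U) where
  add_assoc r s t := ext_of_locally <| (locally₃ r s t).mono
    fun V hV ⟨⟨x, hx⟩, ⟨y, hy⟩, ⟨z, hz⟩⟩ => ⟨_, (hx.add hy).add hz, by
      rw [add_assoc]; exact hx.add (hy.add hz)⟩
  zero_add s := ext_of_locally <| s.locally₁.mono fun V hV ⟨x, hx⟩ =>
    ⟨_, by simpa using (EqOn.zero hV).add hx, hx⟩
  add_zero s := ext_of_locally <| s.locally₁.mono fun V hV ⟨x, hx⟩ =>
    ⟨_, by simpa using hx.add (EqOn.zero hV), hx⟩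
  neg_add_cancel s := ext_of_locally <| s.locally₁.mono fun V hV ⟨x, hx⟩ =>
    ⟨_, hx.neg.add hx, by rw [neg_add_cancel]; exact .zero hV⟩
  add_comm s t := ext_of_locally <| (locally₂ s t).mono
    fun V hV ⟨⟨x, hx⟩, ⟨y, hy⟩⟩ => ⟨_, hx.add hy, by rw [add_comm]; exact hy.add hx⟩
  nsmul := nsmulRec
  zsmul := zsmulRec

instance : CommRing (ConstSection A U) :=
  { (inferInstance : AddCommGroup (ConstSection A U)) with
    mul := fun s t => s * t
    one := 1
    mul_assoc := fun r s t => ext_of_locally <| (locally₃ r s t).mono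
      fun V hV ⟨⟨x, hx⟩, ⟨y, hy⟩, ⟨z, hz⟩⟩ => ⟨_, (hx.mul hy).mul hz, by
        rw [mul_assoc]; exact hx.mul (hy.mul hz)⟩
    one_mul := fun s => ext_of_locally <| s.locally₁.mono fun V hV ⟨x, hx⟩ =>
      ⟨1 * x, (EqOn.one hV).mul hx, by rwa [one_mul]⟩
    mul_one := fun s => ext_of_locally <| s.locally₁.mono fun V hV ⟨x, hx⟩ =>
      ⟨x * 1, hx.mul (EqOn.one hV), by rwa [mul_one]⟩
    zero_mul := fun s => ext_of_locally <| s.locally₁.mono fun V hV ⟨x, hx⟩ =>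
      ⟨_, (EqOn.zero hV).mul hx, by rw [zero_mul]; exact .zero hV⟩
    mul_zero := fun s => ext_of_locally <| s.locally₁.mono fun V hV ⟨x, hx⟩ =>
      ⟨_, hx.mul (.zero hV), by rw [mul_zero]; exact .zero hV⟩
    mul_comm := fun s t => ext_of_locally <| (locally₂ s t).mono
      fun V hV ⟨⟨x, hx⟩, ⟨y, hy⟩⟩ => ⟨_, hx.mul hy, by rw [mul_comm]; exact hy.mul hx⟩
    left_distrib := fun r s t => ext_of_locally <| (locally₃ r s t).mono
      fun V hV ⟨⟨x, hx⟩, ⟨y, hy⟩, ⟨z, hz⟩⟩ => ⟨_, hx.mul (hy.add hz), by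
        rw [mul_add]; exact (hx.mul hy).add (hx.mul hz)⟩
    right_distrib := fun r s t => ext_of_locally <| (locally₃ r s t).mono
      fun V hV ⟨⟨x, hx⟩, ⟨y, hy⟩, ⟨z, hz⟩⟩ => ⟨_, (hx.add hy).mul hz, by
        rw [add_mul]; exact (hx.mul hz).add (hy.mul hz)⟩ }

instance : Module (ConstSection A U) (ConstSection M U) where
  one_smul s := ext_of_locally <| s.locally₁.mono fun V hV ⟨x, hx⟩ =>
    ⟨(1 : A) • x, (EqOn.one hV).smul hx, by rwa [one_smul]⟩
  mul_smul r s t := ext_of_locally <| (locally₃ r s t).mono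
    fun V hV ⟨⟨x, hx⟩, ⟨y, hy⟩, ⟨z, hz⟩⟩ => ⟨_, (hx.mul hy).smul hz, by
      rw [mul_smul]; exact hx.smul (hy.smul hz)⟩
  smul_zero s := ext_of_locally <| s.locally₁.mono fun V hV ⟨x, hx⟩ =>
    ⟨_, hx.smul (.zero hV), by rw [smul_zero]; exact .zero hV⟩
  smul_add r s t := ext_of_locally <| (locally₃ r s t).mono
    fun V hV ⟨⟨x, hx⟩, ⟨y, hy⟩, ⟨z, hz⟩⟩ => ⟨_, hx.smul (hy.add hz), by
      rw [smul_add]; exact (hx.smul hy).add (hx.smul hz)⟩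
  add_smul r s t := ext_of_locally <| (locally₃ r s t).mono
    fun V hV ⟨⟨x, hx⟩, ⟨y, hy⟩, ⟨z, hz⟩⟩ => ⟨_, (hx.add hy).smul hz, by
      rw [add_smul]; exact (hx.smul hz).add (hy.smul hz)⟩
  zero_smul s := ext_of_locally <| s.locally₁.mono fun V hV ⟨x, hx⟩ =>
    ⟨_, (EqOn.zero (M := A) hV).smul hx, by rw [zero_smul]; exact .zero hV⟩

/-! Restriction and the passage from elements to constant sections are compatible with all
operations. -/

theorem res_zero (h : V ≤ U) : (0 : ConstSection M U).res h = 0 :=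
  ext_of_locally (.of ⟨0, (EqOn.zero h).res h le_rfl, .zero le_rfl⟩)

theorem res_one (h : V ≤ U) : (1 : ConstSection A U).res h = 1 :=
  ext_of_locally (.of ⟨1, (EqOn.one h).res h le_rfl, .one le_rfl⟩)

theorem res_of {M : Type u} (h : V ≤ U) (x : M) : (of U x).res h = of V x :=
  ext_of_locally (.of ⟨x, (eqOn_of x h).res h le_rfl, eqOn_of x le_rfl⟩)

theorem res_add (h : V ≤ U) (s t : ConstSection M U) : (s + t).res h = s.res h + t.res h :=
  ext_of_locally <| (locally₂ (s.res h) (t.res h)).mono fun _ hV ⟨⟨_, hx⟩, ⟨_, hy⟩⟩ =>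
    ⟨_, (hx.of_res.add hy.of_res).res h hV, hx.add hy⟩

theorem res_neg (h : V ≤ U) (s : ConstSection M U) : (-s).res h = -s.res h :=
  ext_of_locally <| (locally₁ (s.res h)).mono fun _ hV ⟨_, hx⟩ =>
    ⟨_, hx.of_res.neg.res h hV, hx.neg⟩

theorem res_mul (h : V ≤ U) (s t : ConstSection A U) : (s * t).res h = s.res h * t.res h :=
  ext_of_locally <| (locally₂ (s.res h) (t.res h)).mono fun _ hV ⟨⟨_, hx⟩, ⟨_, hy⟩⟩ =>
    ⟨_, (hx.of_res.mul hy.of_res).res h hV, hx.mul hy⟩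

theorem res_smul (h : V ≤ U) (s : ConstSection A U) (t : ConstSection M U) :
    (s • t).res h = (show ConstSection A V from s.res h) • (show ConstSection M V from t.res h) :=
  ext_of_locally <| (locally₂ (s.res h) (t.res h)).mono fun _ hV ⟨⟨_, hx⟩, ⟨_, hy⟩⟩ =>
    ⟨_, (hx.of_res.smul hy.of_res).res h hV, hx.smul hy⟩

theorem of_one : of U (1 : A) = 1 := rfl

theorem of_mul (x y : A) : of U (x * y) = of U x * of U y :=
  ext_of_locally (.of ⟨_, eqOn_of _ le_rfl, (eqOn_of x le_rfl).mul (eqOn_of y le_rfl)⟩)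

theorem of_smul (x : A) (y : M) : of U (x • y) = of U x • of U y :=
  ext_of_locally (.of ⟨_, eqOn_of _ le_rfl, (eqOn_of x le_rfl).smul (eqOn_of y le_rfl)⟩)

/-- The action of a map of sets on sections of constant sheaves. -/
def map {M N : Type u} (φ : M → N) (s : ConstSection M U) : ConstSection N U :=
  ShSection.map (P := const X M) (Q := const X N) (fun _ => φ) (fun _ _ => rfl) s

theorem EqOn.map {M N : Type u} (φ : M → N) {s : ConstSection M U} {x : M} (hx : s.EqOn V x) :
    (s.map φ).EqOn V (φ x) :=
  ShSection.mem_map (P := const X M) (Q := const X N) (hf := fun _ _ => rfl) hx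

/-- The morphism of constant sheaves of modules induced by a linear map. -/
def mapLinear {N : Type u} [AddCommGroup N] [Module A N] (φ : M →ₗ[A] N) (U : X) :
    ConstSection M U →ₗ[ConstSection A U] ConstSection N U where
  toFun s := s.map φ
  map_add' s t := ext_of_locally <| (locally₂ s t).mono fun _ _ ⟨⟨_, hx⟩, ⟨_, hy⟩⟩ =>
    ⟨_, (hx.add hy).map φ, by rw [map_add]; exact (hx.map φ).add (hy.map φ)⟩
  map_smul' s t := ext_of_locally <| (locally₂ s t).mono fun _ _ ⟨⟨_, hx⟩, ⟨_, hy⟩⟩ =>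
    ⟨_, (hx.smul hy).map φ, by rw [map_smul]; exact hx.smul (hy.map φ)⟩

theorem res_mapLinear {N : Type u} [AddCommGroup N] [Module A N] (φ : M →ₗ[A] N) (h : V ≤ U)
    (s : ConstSection M U) : (mapLinear φ U s).res h = mapLinear φ V (s.res h) :=
  ext_of_locally <| (locally₁ (s.res h)).mono fun _ hV ⟨_, hx⟩ =>
    ⟨_, (hx.of_res.map φ).res h hV, hx.map φ⟩

end

end ConstSection

/-! ### The sheaves `M^~` on the spectrum -/

namespace LocaleSpec

section

variable {A : Type u} [CommRing A]

theorem D_le_D_pow (x : A) (n : ℕ) : D x ≤ D (x ^ n) := by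
  induction n with
  | zero => rw [pow_zero, D_one]; exact le_top
  | succ n ih => rw [pow_succ]; exact (le_inf ih le_rfl).trans (D_inf_le_mul _ _)

/-- The sections over `U` of the generic prime filter, as a subsheaf of the constant sheaf
associated to `A`: those `s` such that, for each `x : A`, the part of `U` on which `s` takes the
value `x` is contained in `[D(x)]`. -/
def genericFilter (U : LocaleSpec A) : Submonoid (ConstSection A U) where
  carrier := {s | ∀ (x : A) (V : LocaleSpec A), s.EqOn V x → V ≤ D x}
  one_mem' x V hx := (hx.locally_eq (.one (ShSection.le _ hx))).trans
    (sSup_le fun W ⟨_, e⟩ => by rw [e, D_one]; exact le_top)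
  mul_mem' {s t} hs ht x V hx := by
    have hVU : V ≤ U := ShSection.le _ hx
    refine ((ConstSection.locally₂ s t).restrict hVU ?_).trans (sSup_le ?_)
    · exact fun _ _ _ h ⟨⟨_, hx⟩, ⟨_, hy⟩⟩ => ⟨⟨_, hx.anti h⟩, ⟨_, hy.anti h⟩⟩
    · rintro W ⟨hW, ⟨a, ha⟩, ⟨b, hb⟩⟩
      refine ((hx.anti hW).locally_eq (ha.mul hb)).trans (sSup_le ?_)
      rintro W' ⟨hW', rfl⟩
      exact (le_inf (hW'.trans (hs a W ha)) (hW'.trans (ht b W hb))).trans (D_inf_le_mul _ _)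

theorem res_mem_genericFilter {U V : LocaleSpec A} (h : V ≤ U) {s : ConstSection A U}
    (hs : s ∈ genericFilter U) : s.res h ∈ genericFilter V :=
  fun x W hx => hs x W hx.1

theorem of_mem_genericFilter {U : LocaleSpec A} {x : A} (h : U ≤ D x) :
    ConstSection.of U x ∈ genericFilter U := fun y V hy => by
  have hVU : V ≤ U := ShSection.le _ hy
  refine ((ConstSection.eqOn_of x hVU).locally_eq hy).trans (sSup_le ?_)
  rintro W ⟨hW, rfl⟩
  exact hW.trans (hVU.trans h)

variable (A)
variable (M : Type u) [AddCommGroup M] [Module A M] (N : Type u) [AddCommGroup N] [Module A N]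

/-- The module of fractions `m / s`, where `m` is a section over `U` of the constant sheaf
associated to `M` and `s` is a section over `U` of the generic prime filter. -/
abbrev Frac (U : LocaleSpec A) : Type (u + 1) :=
  LocalizedModule (genericFilter U) (ConstSection M U)

variable {A M N}

/-- Restriction of fractions. -/
def Frac.res {U V : LocaleSpec A} (h : V ≤ U) (x : Frac A M U) : Frac A M V :=
  LocalizedModule.liftOn x
    (fun p => LocalizedModule.mk (show ConstSection M V from p.1.res h)
      ⟨p.2.1.res h, res_mem_genericFilter h p.2.2⟩)
    (by
      rintro ⟨m, s⟩ ⟨m', s'⟩ ⟨u, hu⟩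
      refine LocalizedModule.mk_eq.2 ⟨⟨u.1.res h, res_mem_genericFilter h u.2⟩, ?_⟩
      have e := congrArg (ShSection.res h) hu
      simp only [Submonoid.smul_def, ConstSection.res_smul] at e
      exact e)

theorem Frac.res_mk {U V : LocaleSpec A} (h : V ≤ U) (m : ConstSection M U)
    (s : genericFilter U) : Frac.res h (LocalizedModule.mk m s) =
      LocalizedModule.mk (show ConstSection M V from m.res h)
        ⟨s.1.res h, res_mem_genericFilter h s.2⟩ := LocalizedModule.liftOn_mk _ _ _

variable (A M) in
/-- The presheaf of fractions. -/
abbrev fracPresheaf : LocalePresheaf (LocaleSpec A) where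
  obj U := Frac A M U
  res h x := Frac.res h x
  res_id x := by
    refine LocalizedModule.induction_on (fun m s => ?_) x
    rw [Frac.res_mk]
    congr 1
    · exact (LocalePresheaf.const _ M).sheafify.res_id m
    · exact Subtype.ext ((LocalePresheaf.const _ A).sheafify.res_id s.1)
  res_res h h' x := by
    refine LocalizedModule.induction_on (fun m s => ?_) x
    rw [Frac.res_mk, Frac.res_mk, Frac.res_mk]
    congr 1
    · exact (LocalePresheaf.const _ M).sheafify.res_res h h' m
    · exact Subtype.ext ((LocalePresheaf.const _ A).sheafify.res_res h h' s.1)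

variable (A M) in
/-- The sheaf `M^~` on `Spec(A)`: the localization of the constant sheaf associated to `M` at the
generic prime filter. For `M = A` it is the structure sheaf `A^~`. -/
def tilde : LocalePresheaf (LocaleSpec A) := (fracPresheaf A M).sheafify

variable (A M) in
theorem tilde_isSheaf : (tilde A M).IsSheaf := sheafify_isSheaf _

theorem Frac.res_add {U V : LocaleSpec A} (h : V ≤ U) (x y : Frac A M U) :
    Frac.res h (x + y) = Frac.res h x + Frac.res h y := by
  induction x, y using LocalizedModule.induction_on₂ with | _ m m' s s'
  rw [LocalizedModule.mk_add_mk, Frac.res_mk, Frac.res_mk, Frac.res_mk, LocalizedModule.mk_add_mk]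
  congr 1
  · exact (ConstSection.res_add h _ _).trans
      (congrArg₂ (· + ·) (ConstSection.res_smul h _ _) (ConstSection.res_smul h _ _))
  · exact Subtype.ext (ConstSection.res_mul h _ _)

theorem Frac.res_neg {U V : LocaleSpec A} (h : V ≤ U) (x : Frac A M U) :
    Frac.res h (-x) = -Frac.res h x := by
  refine LocalizedModule.induction_on (fun m s => ?_) x
  rw [← LocalizedModule.mk_neg, Frac.res_mk, Frac.res_mk, ← LocalizedModule.mk_neg]
  congr 1
  exact ConstSection.res_neg h _

theorem Frac.res_smul {U V : LocaleSpec A} (h : V ≤ U) (x : Frac A A U) (y : Frac A M U) :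
    Frac.res h (x • y) = Frac.res h x • Frac.res h y := by
  refine LocalizedModule.induction_on (fun a s => ?_) x
  refine LocalizedModule.induction_on (fun m t => ?_) y
  have e : (LocalizedModule.mk a s • LocalizedModule.mk m t : Frac A M U) =
    LocalizedModule.mk (a • m) (s * t) := LocalizedModule.mk_smul_mk _ _ _ _
  rw [e, Frac.res_mk, Frac.res_mk, Frac.res_mk]
  refine Eq.trans ?_ (LocalizedModule.mk_smul_mk _ _ _ _).symm
  congr 1
  · exact ConstSection.res_smul h _ _
  · exact Subtype.ext (ConstSection.res_mul h _ _)

theorem Frac.res_mul {U V : LocaleSpec A} (h : V ≤ U) (x y : Frac A A U) :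
    Frac.res h (x * y) = Frac.res h x * Frac.res h y := by
  refine LocalizedModule.induction_on₂ (fun a b s t => ?_) x y
  have e : ∀ {W : LocaleSpec A} (a b : ConstSection A W) (s t : genericFilter W),
      (LocalizedModule.mk a s * LocalizedModule.mk b t : Frac A A W) =
        LocalizedModule.mk (a * b) (s * t) := fun _ _ _ _ => LocalizedModule.mk_mul_mk
  rw [e, Frac.res_mk, Frac.res_mk, Frac.res_mk, e]
  congr 1
  · exact ConstSection.res_mul h _ _
  · exact Subtype.ext (ConstSection.res_mul h _ _)

/-- The map on fractions induced by a linear map. -/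
noncomputable def Frac.map (φ : M →ₗ[A] N) (U : LocaleSpec A) : Frac A M U → Frac A N U :=
  IsLocalizedModule.map (genericFilter U)
    (LocalizedModule.mkLinearMap (genericFilter U) (ConstSection M U))
    (LocalizedModule.mkLinearMap (genericFilter U) (ConstSection N U))
    (ConstSection.mapLinear φ U)

theorem Frac.map_mk (φ : M →ₗ[A] N) (U : LocaleSpec A) (m : ConstSection M U)
    (s : genericFilter U) : Frac.map φ U (LocalizedModule.mk m s) =
      LocalizedModule.mk (ConstSection.mapLinear φ U m) s :=
  IsLocalizedModule.map_LocalizedModules _ _ _ _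

theorem Frac.res_map (φ : M →ₗ[A] N) {U V : LocaleSpec A} (h : V ≤ U) (x : Frac A M U) :
    Frac.res h (Frac.map φ U x) = Frac.map φ V (Frac.res h x) := by
  refine LocalizedModule.induction_on (fun m s => ?_) x
  rw [Frac.map_mk, Frac.res_mk, Frac.res_mk, Frac.map_mk]
  congr 1
  exact ConstSection.res_mapLinear φ h m

/-! The structure of `A^~` as a sheaf of rings, of `M^~` as a sheaf of `A^~`-modules, and the
morphisms `M^~ → N^~` induced by linear maps. -/

namespace tilde

variable {U : LocaleSpec A}

/-- The section of `M^~` given by a fraction. -/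
def ofFrac (x : Frac A M U) : (tilde A M).obj U := ShSection.unit (P := fracPresheaf A M) x

def zero (U : LocaleSpec A) : (tilde A M).obj U := ofFrac 0

def one (U : LocaleSpec A) : (tilde A A).obj U := ofFrac 1

def add (x y : (tilde A M).obj U) : (tilde A M).obj U :=
  ShSection.map₂ (P := fracPresheaf A M) (Q := fracPresheaf A M) (R := fracPresheaf A M)
    (fun _ a b => a + b) Frac.res_add x y

def neg (x : (tilde A M).obj U) : (tilde A M).obj U :=
  ShSection.map (P := fracPresheaf A M) (Q := fracPresheaf A M) (fun _ a => -a) Frac.res_neg x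

def mul (x y : (tilde A A).obj U) : (tilde A A).obj U :=
  ShSection.map₂ (P := fracPresheaf A A) (Q := fracPresheaf A A) (R := fracPresheaf A A)
    (fun _ a b => a * b) Frac.res_mul x y

def smul (x : (tilde A A).obj U) (y : (tilde A M).obj U) : (tilde A M).obj U :=
  ShSection.map₂ (P := fracPresheaf A A) (Q := fracPresheaf A M) (R := fracPresheaf A M)
    (fun _ a b => a • b) Frac.res_smul x y

noncomputable def map (φ : M →ₗ[A] N) (x : (tilde A M).obj U) : (tilde A N).obj U :=
  ShSection.map (P := fracPresheaf A M) (Q := fracPresheaf A N) (Frac.map φ) (Frac.res_map φ) x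

/-- The canonical map `M[f⁻¹] → M^~([D(f)])`, sending `m / f ^ n` to the fraction of the constant
sections `m` and `f ^ n`. -/
def ofAway {f : A} (x : LocalizedModule (Submonoid.powers f) M) : (tilde A M).obj (D f) :=
  ofFrac <| LocalizedModule.liftOn x
    (fun p => LocalizedModule.mk (ConstSection.of (D f) p.1) ⟨ConstSection.of (D f) p.2.1, by
      obtain ⟨n, hn⟩ := p.2.2
      refine of_mem_genericFilter ?_
      rw [← hn]
      exact D_le_D_pow f n⟩)
    (by
      rintro ⟨m, s⟩ ⟨m', s'⟩ ⟨t, ht⟩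
      obtain ⟨n, hn⟩ := t.2
      refine LocalizedModule.mk_eq.2 ⟨⟨ConstSection.of (D f) t.1, of_mem_genericFilter ?_⟩, ?_⟩
      · rw [← hn]
        exact D_le_D_pow f n
      · have e := congrArg (ConstSection.of (D f)) ht
        simp only [Submonoid.smul_def, ConstSection.of_smul] at e
        exact e)

end tilde

end

end LocaleSpec

/-! ### Formulas over a ring element -/

section

variable {A : Type u} [CommRing A]

/-- Terms over `f : A` with free variables of the sorts listed in `Γ`. The sorts are the
`A`-modules `M`, standing for `M^~`; the sort of the module `A` stands for the ring `A^~`. -/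
inductive TildeTerm (f : A) (Γ : List (ModuleCat.{u} A)) : ModuleCat.{u} A → Type (u + 1)
  | var (i : Fin Γ.length) : TildeTerm f Γ (Γ.get i)
  | const {M : ModuleCat.{u} A} (x : LocalizedModule (Submonoid.powers f) M) : TildeTerm f Γ M
  | zero {M : ModuleCat.{u} A} : TildeTerm f Γ M
  | add {M : ModuleCat.{u} A} (s t : TildeTerm f Γ M) : TildeTerm f Γ M
  | neg {M : ModuleCat.{u} A} (s : TildeTerm f Γ M) : TildeTerm f Γ M
  | one : TildeTerm f Γ (ModuleCat.of A A)
  | mul (s t : TildeTerm f Γ (ModuleCat.of A A)) : TildeTerm f Γ (ModuleCat.of A A)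
  | smul {M : ModuleCat.{u} A} (s : TildeTerm f Γ (ModuleCat.of A A)) (t : TildeTerm f Γ M) :
      TildeTerm f Γ M
  | map {M N : ModuleCat.{u} A} (φ : M →ₗ[A] N) (t : TildeTerm f Γ M) : TildeTerm f Γ N

/-- First-order formulas over `f : A` with free variables of the sorts listed in `Γ`. -/
inductive TildeFormula (f : A) : List (ModuleCat.{u} A) → Type (u + 1)
  | eq {Γ} {M : ModuleCat.{u} A} (s t : TildeTerm f Γ M) : TildeFormula f Γ
  | top {Γ} : TildeFormula f Γ
  | bot {Γ} : TildeFormula f Γ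
  | and {Γ} (φ ψ : TildeFormula f Γ) : TildeFormula f Γ
  | or {Γ} (φ ψ : TildeFormula f Γ) : TildeFormula f Γ
  | imp {Γ} (φ ψ : TildeFormula f Γ) : TildeFormula f Γ
  | all {Γ} (M : ModuleCat.{u} A) (φ : TildeFormula f (M :: Γ)) : TildeFormula f Γ
  | ex {Γ} (M : ModuleCat.{u} A) (φ : TildeFormula f (M :: Γ)) : TildeFormula f Γ

/-- Extend a valuation `γ` of the variables in `Γ` by the value `x` of a new variable. -/
def valCons {val : ModuleCat.{u} A → Type w} {Γ : List (ModuleCat.{u} A)} {M : ModuleCat.{u} A}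
    (x : val M) (γ : ∀ i : Fin Γ.length, val (Γ.get i)) :
    ∀ i : Fin (M :: Γ).length, val ((M :: Γ).get i) :=
  Fin.cases x γ

/-! ### The sheaf semantics -/

open LocaleSpec

/-- The value of a term as a section over an open `U ≤ [D(f)]`, given sections over `U` for its
variables. Constants from `M[f⁻¹]` denote sections over `[D(f)]`, restricted to `U`. -/
noncomputable def TildeTerm.sheafEval {f : A} {Γ : List (ModuleCat.{u} A)} {U : LocaleSpec A} (hU : U ≤ D f)
    (γ : ∀ i : Fin Γ.length, (tilde A (Γ.get i)).obj U) :
    ∀ {M : ModuleCat.{u} A}, TildeTerm f Γ M → (tilde A M).obj U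
  | _, var i => γ i
  | M, const x => (tilde A M).res hU (tilde.ofAway x)
  | _, zero => tilde.zero U
  | _, add s t => tilde.add (s.sheafEval hU γ) (t.sheafEval hU γ)
  | _, neg s => tilde.neg (s.sheafEval hU γ)
  | _, one => tilde.one U
  | _, mul s t => tilde.mul (A := A) (s.sheafEval hU γ) (t.sheafEval hU γ)
  | _, smul s t => tilde.smul (A := A) (s.sheafEval hU γ) (t.sheafEval hU γ)
  | _, map φ t => tilde.map φ (t.sheafEval hU γ)

/-- The sheaf semantics: `U ⊨ φ` for a formula `φ` over `f`, an open `U ≤ [D(f)]`, and sections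
over `U` for the free variables of `φ`. -/
noncomputable def TildeFormula.SheafForces {f : A} : ∀ {Γ : List (ModuleCat.{u} A)}, TildeFormula f Γ →
    ∀ U : LocaleSpec A, U ≤ D f → (∀ i : Fin Γ.length, (tilde A (Γ.get i)).obj U) → Prop
  | _, eq s t, _, hU, γ => s.sheafEval hU γ = t.sheafEval hU γ
  | _, top, _, _, _ => True
  | _, bot, U, _, _ => U = ⊥
  | _, and φ ψ, U, hU, γ => φ.SheafForces U hU γ ∧ ψ.SheafForces U hU γ
  | Γ, or φ ψ, U, hU, γ =>
      ∃ (ι : Type (u + 1)) (V : ι → LocaleSpec A) (hV : ∀ i, V i ≤ U), U = ⨆ i, V i ∧ ∀ i,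
        φ.SheafForces (V i) ((hV i).trans hU) (fun k => (tilde A (Γ.get k)).res (hV i) (γ k)) ∨
        ψ.SheafForces (V i) ((hV i).trans hU) (fun k => (tilde A (Γ.get k)).res (hV i) (γ k))
  | Γ, imp φ ψ, U, hU, γ => ∀ (V : LocaleSpec A) (hV : V ≤ U),
      φ.SheafForces V (hV.trans hU) (fun k => (tilde A (Γ.get k)).res hV (γ k)) →
      ψ.SheafForces V (hV.trans hU) (fun k => (tilde A (Γ.get k)).res hV (γ k))
  | Γ, all M φ, U, hU, γ => ∀ (V : LocaleSpec A) (hV : V ≤ U) (x : (tilde A M).obj V),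
      φ.SheafForces V (hV.trans hU) (valCons (val := fun M => (tilde A M).obj V) x
        fun k => (tilde A (Γ.get k)).res hV (γ k))
  | Γ, ex M φ, U, hU, γ =>
      ∃ (ι : Type (u + 1)) (V : ι → LocaleSpec A) (hV : ∀ i, V i ≤ U), U = ⨆ i, V i ∧ ∀ i,
        ∃ x : (tilde A M).obj (V i), φ.SheafForces (V i) ((hV i).trans hU)
          (valCons (val := fun M => (tilde A M).obj (V i)) x
            fun k => (tilde A (Γ.get k)).res (hV i) (γ k))

/-! ### The algebraic semantics -/

/-- The canonical map `M[f⁻¹] → M[g⁻¹]` for `f ∣ g`. -/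
noncomputable def awayRes {f g : A} (h : f ∣ g) (M : Type u) [AddCommGroup M] [Module A M] :
    LocalizedModule (Submonoid.powers f) M →ₗ[A] LocalizedModule (Submonoid.powers g) M :=
  LocalizedModule.lift (Submonoid.powers f) (LocalizedModule.mkLinearMap (Submonoid.powers g) M)
    (by
      rintro ⟨_, n, rfl⟩
      obtain ⟨c, rfl⟩ := h
      have hu := IsLocalizedModule.map_units
        (LocalizedModule.mkLinearMap (Submonoid.powers (f * c)) M)
        (⟨(f * c) ^ n, n, rfl⟩ : Submonoid.powers (f * c))
      have e : ((⟨(f * c) ^ n, n, rfl⟩ : Submonoid.powers (f * c)) : A) = f ^ n * c ^ n :=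
        mul_pow f c n
      rw [e, map_mul] at hu
      exact ((Commute.all (f ^ n) (c ^ n)).map _).isUnit_mul_iff.1 hu |>.1)

/-- The value of a term in the localizations away from `g`, where `f ∣ g`, given values in these
localizations for its variables. -/
noncomputable def TildeTerm.algEval {f : A} {Γ : List (ModuleCat.{u} A)} {g : A} (hg : f ∣ g)
    (γ : ∀ i : Fin Γ.length, LocalizedModule (Submonoid.powers g) (Γ.get i)) :
    ∀ {M : ModuleCat.{u} A}, TildeTerm f Γ M → LocalizedModule (Submonoid.powers g) M
  | _, var i => γ i
  | M, const x => awayRes hg M x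
  | _, zero => 0
  | _, add s t => s.algEval hg γ + t.algEval hg γ
  | _, neg s => -s.algEval hg γ
  | _, one => (1 : Localization.Away g)
  | _, mul s t => (s.algEval hg γ * t.algEval hg γ : Localization.Away g)
  | _, smul s t => (s.algEval hg γ : Localization.Away g) • t.algEval hg γ
  | _, @map _ _ _ _ M N φ t => IsLocalizedModule.map (Submonoid.powers g)
      (LocalizedModule.mkLinearMap (Submonoid.powers g) M)
      (LocalizedModule.mkLinearMap (Submonoid.powers g) N) φ (t.algEval hg γ)

/-- The algebraic semantics: `g ⊨ φ` for a formula `φ` over `f`, an element `g` divisible by `f`,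
and elements of the localizations away from `g` for the free variables of `φ`. -/
noncomputable def TildeFormula.AlgForces {f : A} : ∀ {Γ : List (ModuleCat.{u} A)}, TildeFormula f Γ →
    ∀ g : A, f ∣ g → (∀ i : Fin Γ.length, LocalizedModule (Submonoid.powers g) (Γ.get i)) → Prop
  | _, eq s t, _, hg, γ => s.algEval hg γ = t.algEval hg γ
  | _, top, _, _, _ => True
  | _, bot, g, _, _ => IsNilpotent g
  | _, and φ ψ, g, hg, γ => φ.AlgForces g hg γ ∧ ψ.AlgForces g hg γ
  | Γ, or φ ψ, g, hg, γ => ∃ (n m : ℕ) (h : Fin m → A), g ^ n = ∑ i, g * h i ∧ ∀ i,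
      φ.AlgForces (g * h i) (hg.mul_right _) (fun k => awayRes (Dvd.intro _ rfl) (Γ.get k) (γ k)) ∨
      ψ.AlgForces (g * h i) (hg.mul_right _) (fun k => awayRes (Dvd.intro _ rfl) (Γ.get k) (γ k))
  | Γ, imp φ ψ, g, hg, γ => ∀ h : A,
      φ.AlgForces (g * h) (hg.mul_right _) (fun k => awayRes (Dvd.intro _ rfl) (Γ.get k) (γ k)) →
      ψ.AlgForces (g * h) (hg.mul_right _) (fun k => awayRes (Dvd.intro _ rfl) (Γ.get k) (γ k))
  | Γ, all M φ, g, hg, γ => ∀ (h : A) (x : LocalizedModule (Submonoid.powers (g * h)) M),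
      φ.AlgForces (g * h) (hg.mul_right _)
        (valCons (val := fun M => LocalizedModule (Submonoid.powers (g * h)) M) x
          fun k => awayRes (Dvd.intro _ rfl) (Γ.get k) (γ k))
  | Γ, ex M φ, g, hg, γ => ∃ (n m : ℕ) (h : Fin m → A), g ^ n = ∑ i, g * h i ∧ ∀ i,
      ∃ x : LocalizedModule (Submonoid.powers (g * h i)) M,
        φ.AlgForces (g * h i) (hg.mul_right _)
          (valCons (val := fun M => LocalizedModule (Submonoid.powers (g * h i)) M) x
            fun k => awayRes (Dvd.intro _ rfl) (Γ.get k) (γ k))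

end

/-! The proof is an induction on formulas, comparing both semantics on a basic open `[D(g)]` when
the free variables take values in the localizations `M[g⁻¹]`, read as sections through
`tilde.ofAway` (`sheafForces_iff_algForces`). Three groups of facts make every clause match.

The order on opens is controlled by algebra. Basic opens generate all opens, and if `[D(x)]` is
covered by opens whose basic subopens all come from elements of `I.radical`, then `x` lies in
`I.radical` (`mem_radical_of_D_le_sSup`). This is read off from prime ideals: each gives a model of
the theory, derivations are sound in it, and a radical is an intersection of primes. Consequently
`[D(x)]` is empty exactly for nilpotent `x`, and coverings of `[D(g)]` can be replaced by partitions
of `g` (`exists_partition_of_locally`).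

The sections of `M^~` are controlled by localizations. The map `tilde.ofAway` commutes with all
operations and with restriction, it is injective (`ofAway_injective`), and every section is locally
in its image (`locally_exists_ofAway`). Surjectivity over a fixed `[D(g)]` is never needed, because
truth is local.

Finally, sheaf forcing passes to smaller opens (`SheafForces.res`) and can be checked on a covering
(`SheafForces.of_locally`). Hence the quantification over all opens and all sections in the clauses
for implication and the universal quantifier reduces to basic opens `[D(g * h)]` and elements of
`M[(g * h)⁻¹]`. -/

/-! ### Prime ideals as models of the theory of prime filters -/

namespace GeomFormula

/-- The truth value of a geometric formula in the model given by a prime ideal: the atom `D(x)`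
holds if `x` is not a member of the ideal. -/
def HoldsAt {A : Type u} [CommRing A] (p : PrimeSpectrum A) : GeomFormula A → Prop
  | atom x => x ∉ p.asIdeal
  | top => True
  | and φ ψ => φ.HoldsAt p ∧ ψ.HoldsAt p
  | bot => False
  | or φ ψ => φ.HoldsAt p ∨ ψ.HoldsAt p
  | sup _ φ => ∃ i, (φ i).HoldsAt p

/-- Soundness: the complement of a prime ideal is a prime filter, so it validates the axioms, and
the rules of geometric logic preserve truth. -/
theorem HoldsAt.of_proves {A : Type u} [CommRing A] {p : PrimeSpectrum A} {φ ψ : GeomFormula A}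
    (h : Theory.Proves (primeFilterTheory A) φ ψ) : φ.HoldsAt p → ψ.HoldsAt p := by
  induction h with
  | ax h =>
    cases h with
    | zero => exact fun h => h p.asIdeal.zero_mem
    | add x y =>
      intro h
      by_contra h'
      simp only [HoldsAt, not_or, not_not] at h'
      exact h (p.asIdeal.add_mem h'.1 h'.2)
    | of_mul x y => exact fun h h' => h (p.asIdeal.mul_mem_right y h')
    | one => exact fun _ h => p.2.ne_top ((Ideal.eq_top_iff_one _).2 h)
    | mul x y => exact fun h h' => (p.2.mem_or_mem h').elim h.1 h.2
  | refl φ => exact id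
  | trans _ _ ih ih' => exact ih' ∘ ih
  | top φ => exact fun _ => trivial
  | and_left φ ψ => exact And.left
  | and_right φ ψ => exact And.right
  | and_intro _ _ ih ih' => exact fun h => ⟨ih h, ih' h⟩
  | bot φ => exact False.elim
  | or_left φ ψ => exact Or.inl
  | or_right φ ψ => exact Or.inr
  | or_elim _ _ ih ih' => exact fun h => h.elim ih ih'
  | sup_intro φ i => exact fun h => ⟨i, h⟩
  | sup_elim _ ih => exact fun ⟨i, h⟩ => ih i h
  | distrib φ ψ => exact fun ⟨⟨i, h⟩, h'⟩ => ⟨i, h, h'⟩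

end GeomFormula

/-! ### Coverings and local truth -/

namespace LocalePresheaf

variable {X : Type v} [Order.Frame X]

/-- Translates the indexed coverings in the clauses for disjunction and existence into `Locally`.
The opens on which `p` holds can themselves serve as index set, since `X` lives in the universe of
the index types. -/
theorem locally_iff_exists_cover {U : X} {p : ∀ V : X, V ≤ U → Prop} :
    Locally U p ↔ ∃ (ι : Type v) (V : ι → X) (hV : ∀ i, V i ≤ U), U = ⨆ i, V i ∧
      ∀ i, p (V i) (hV i) := by
  constructor
  · intro h
    refine ⟨{V | ∃ h : V ≤ U, p V h}, Subtype.val, fun i => i.2.1, ?_, fun i => i.2.2⟩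
    rw [← sSup_eq_iSup']
    exact le_antisymm h (sSup_le fun _ hV => hV.1)
  · rintro ⟨ι, V, hV, hU, h⟩
    exact hU.le.trans (iSup_le fun i => le_sSup ⟨hV i, h i⟩)

end LocalePresheaf

/-! ### Order relations between basic opens -/

namespace LocaleSpec

open GeomFormula GeomFormula.Theory

variable {A : Type u} [CommRing A]

theorem D_mul (x y : A) : D (x * y) = D x ⊓ D y :=
  le_antisymm (le_inf (D_mul_le_left x y) (mul_comm x y ▸ D_mul_le_left y x)) (D_inf_le_mul x y)

theorem D_le_of_dvd {x y : A} (h : x ∣ y) : D y ≤ D x := by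
  obtain ⟨c, rfl⟩ := h
  exact D_mul_le_left x c

theorem D_zero : D (0 : A) = ⊥ :=
  le_bot_iff.1 (le_trans (Proves.ax .zero) Lindenbaum.mk_bot.le)

theorem D_add_le (x y : A) : D (x + y) ≤ D x ⊔ D y :=
  le_trans (Proves.ax (.add x y)) (Lindenbaum.mk_or _ _).le

theorem D_sum_le {ι : Type*} (s : Finset ι) (x : ι → A) {U : LocaleSpec A}
    (h : ∀ i ∈ s, D (x i) ≤ U) : D (∑ i ∈ s, x i) ≤ U :=
  Finset.sum_induction x (fun a => D a ≤ U) (fun a b ha hb => (D_add_le a b).trans (sup_le ha hb))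
    (D_zero.trans_le bot_le) h

theorem mk_conj (l : List A) :
    (Lindenbaum.mk (conj l) : LocaleSpec A) = D l.prod := by
  induction l with
  | nil => exact Lindenbaum.mk_top.trans D_one.symm
  | cons x l ih =>
    rw [List.prod_cons, D_mul, ← ih]
    rfl

/-- The point of `Spec(A)` given by a prime ideal, as a predicate on the opens. -/
def HoldsAt (p : PrimeSpectrum A) : LocaleSpec A → Prop :=
  Quotient.lift (GeomFormula.HoldsAt p) fun _ _ h =>
    propext ⟨HoldsAt.of_proves h.1, HoldsAt.of_proves h.2⟩

theorem HoldsAt.mono {p : PrimeSpectrum A} {U V : LocaleSpec A} (h : U ≤ V) (hU : HoldsAt p U) :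
    HoldsAt p V := by
  obtain ⟨φ, rfl⟩ := Lindenbaum.mk_surjective U
  obtain ⟨ψ, rfl⟩ := Lindenbaum.mk_surjective V
  exact GeomFormula.HoldsAt.of_proves h hU

theorem holdsAt_D {p : PrimeSpectrum A} {x : A} : HoldsAt p (D x) ↔ x ∉ p.asIdeal := Iff.rfl

/-- A join is by construction a disjunction of finite conjunctions of atoms, each entailing a member
of `S`. The disjunct true at `p` is the basic open of the product of its atoms, which supplies `x`.
-/
theorem HoldsAt.exists_of_sSup {p : PrimeSpectrum A} {S : Set (LocaleSpec A)}
    (h : HoldsAt p (sSup S)) : ∃ U ∈ S, ∃ x : A, D x ≤ U ∧ x ∉ p.asIdeal := by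
  obtain ⟨⟨l, U, hU, hl⟩, h⟩ := h
  refine ⟨U, hU, l.prod, (mk_conj l).symm.trans_le hl, ?_⟩
  rw [← holdsAt_D, ← mk_conj]
  exact h

theorem le_sSup_D (U : LocaleSpec A) : U ≤ sSup {V | V ≤ U ∧ ∃ x, V = D x} := by
  obtain ⟨φ, rfl⟩ := Lindenbaum.mk_surjective U
  refine (Lindenbaum.mk_le_mk.2 (normalForm (primeFilterTheory A) φ)).trans ?_
  rw [Lindenbaum.mk_sup]
  exact iSup_le fun l => le_sSup ⟨l.2, _, mk_conj _⟩

/-- A prime `J` containing `I` but not `x` would be a point of `[D(x)]`, hence of some `[D(y)]`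
below a member of the covering; then `y` is outside `J` although it lies in the radical of `I`. This
is the only passage from coverings by arbitrary families to ring elements. -/
theorem mem_radical_of_D_le_sSup {x : A} {S : Set (LocaleSpec A)} {I : Ideal A}
    (h : D x ≤ sSup S) (hS : ∀ U ∈ S, ∀ y, D y ≤ U → y ∈ I.radical) : x ∈ I.radical := by
  rw [Ideal.radical_eq_sInf, Ideal.mem_sInf]
  rintro J ⟨hI, hJ⟩
  by_contra hx
  obtain ⟨U, hU, y, hy, hyJ⟩ := (HoldsAt.mono (p := ⟨J, hJ⟩) h hx).exists_of_sSup
  exact hyJ (hJ.radical_le_iff.2 hI (hS U hU y hy))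

theorem exists_pow_eq_mul_of_D_le {x y : A} (h : D x ≤ D y) : ∃ (n : ℕ) (b : A), x ^ n = y * b := by
  have hx : x ∈ (Ideal.span {y}).radical := by
    rw [Ideal.radical_eq_sInf, Ideal.mem_sInf]
    rintro J ⟨hI, hJ⟩
    by_contra hx
    exact HoldsAt.mono (p := ⟨J, hJ⟩) h hx (hI (Ideal.mem_span_singleton_self y))
  obtain ⟨n, hn⟩ := hx
  exact ⟨n, Ideal.mem_span_singleton.1 hn⟩

theorem D_eq_bot_iff {x : A} : D x = ⊥ ↔ IsNilpotent x := by
  constructor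
  · intro h
    obtain ⟨n, b, hn⟩ := exists_pow_eq_mul_of_D_le (h.trans D_zero.symm).le
    exact ⟨n, hn.trans (zero_mul b)⟩
  · rintro ⟨n, hn⟩
    exact le_bot_iff.1 ((D_le_D_pow x n).trans (by rw [hn, D_zero]))

/-- A property that holds locally on `[D(g)]` and is inherited by smaller opens holds on the
members `[D(g * h i)]` of a partition of `g`. -/
theorem exists_partition_of_locally {g : A} {p : ∀ V : LocaleSpec A, V ≤ D g → Prop}
    (hp : Locally (D g) p)
    (hres : ∀ (W W' : LocaleSpec A) (hW : W ≤ D g) (hW' : W' ≤ W), p W hW → p W' (hW'.trans hW)) :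
    ∃ (n m : ℕ) (h : Fin m → A), g ^ n = ∑ i, g * h i ∧
      ∀ i, p (D (g * h i)) (D_mul_le_left g (h i)) := by
  -- The ideal is generated by the elements whose basic opens lie in `[D(g)]` and satisfy `p`; since
  -- `p` is inherited, every basic open below a member of the covering contributes a generator.
  obtain ⟨n, hn⟩ := mem_radical_of_D_le_sSup (I := Ideal.span {y | ∃ h : D y ≤ D g, p (D y) h})
    hp fun U hU y hy =>
      Ideal.le_radical (Ideal.subset_span ⟨hy.trans hU.1, hres U _ hU.1 hy hU.2⟩)
  obtain ⟨m, c, y, hy⟩ := Submodule.mem_span_set'.1 hn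
  -- The combination `g ^ n = ∑ c i * y i` is multiplied by `g` to get the shape of a partition,
  -- whence the exponent `n + 1`. Each summand remains a multiple of `y i`, so it inherits `p`.
  refine ⟨n + 1, m, fun i => c i * (y i).1, ?_, fun i => ?_⟩
  · rw [← Finset.mul_sum, pow_succ', ← hy]
    rfl
  · exact hres (D (y i).1) _ (y i).2.1 (D_le_of_dvd ((Dvd.intro_left _ rfl).mul_left _)) (y i).2.2

theorem locally_of_partition {g : A} {p : ∀ V : LocaleSpec A, V ≤ D g → Prop} {n m : ℕ}
    {h : Fin m → A} (hg : g ^ n = ∑ i, g * h i)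
    (hp : ∀ i, p (D (g * h i)) (D_mul_le_left g (h i))) : Locally (D g) p := by
  refine (D_le_D_pow g n).trans ?_
  rw [hg]
  exact D_sum_le _ _ fun i _ => le_sSup ⟨_, hp i⟩

/-- Below `[D(g)]` the opens `[D(g * h)]` already form a basis, because `[D(x)] ≤ [D(g)]` forces
`[D(x)] = [D(g * x)]`. This lets the algebraic semantics range over multiples of `g` only. -/
theorem locally_of_forall_D {g : A} {U : LocaleSpec A} (hU : U ≤ D g)
    {p : ∀ V : LocaleSpec A, V ≤ U → Prop} (hp : ∀ h (hV : D (g * h) ≤ U), p (D (g * h)) hV) :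
    Locally U p := by
  refine (le_sSup_D U).trans (sSup_le ?_)
  rintro _ ⟨hV, x, rfl⟩
  have e : D x = D (g * x) := by rw [D_mul, inf_eq_right.2 (hV.trans hU)]
  rw [e] at hV ⊢
  exact le_sSup ⟨hV, hp x hV⟩

end LocaleSpec

/-! ### Compatibilities of sheafification and constant sections -/

namespace LocalePresheaf.ShSection

variable {X : Type v} [Order.Frame X] {P Q R : LocalePresheaf.{v, w} X} {U V : X}

theorem map_unit {f : ∀ V, P.obj V → Q.obj V}
    {hf : ∀ {W V : X} (h : W ≤ V) (x : P.obj V), Q.res h (f V x) = f W (P.res h x)}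
    (x : P.obj U) : map f hf (unit x) = unit (f U x) :=
  ext_of_locally (.of ⟨_, mem_map (mem_unit x), mem_unit _⟩)

theorem map₂_unit {f : ∀ V, P.obj V → Q.obj V → R.obj V}
    {hf : ∀ {W V : X} (h : W ≤ V) (x : P.obj V) (y : Q.obj V),
      R.res h (f V x y) = f W (P.res h x) (Q.res h y)}
    (x : P.obj U) (y : Q.obj U) : map₂ f hf (unit x) (unit y) = unit (f U x y) :=
  ext_of_locally (.of ⟨_, mem_map₂ (mem_unit x) (mem_unit y), mem_unit _⟩)

theorem res_unit (h : V ≤ U) (x : P.obj U) : (unit x).res h = unit (P.res h x) :=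
  ext_of_locally (.of ⟨_, ⟨res_mem_unit x h, le_rfl⟩, mem_unit _⟩)

theorem res_map {f : ∀ V, P.obj V → Q.obj V}
    {hf : ∀ {W V : X} (h : W ≤ V) (x : P.obj V), Q.res h (f V x) = f W (P.res h x)}
    (h : V ≤ U) (σ : ShSection P U) : (map f hf σ).res h = map f hf (σ.res h) :=
  ext_of_locally ((σ.res h).locally_exists.mono fun _ hW ⟨_, hx⟩ =>
    ⟨_, ⟨mem_map hx.1, hW⟩, mem_map hx⟩)

theorem res_map₂ {f : ∀ V, P.obj V → Q.obj V → R.obj V}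
    {hf : ∀ {W V : X} (h : W ≤ V) (x : P.obj V) (y : Q.obj V),
      R.res h (f V x y) = f W (P.res h x) (Q.res h y)}
    (h : V ≤ U) (σ : ShSection P U) (τ : ShSection Q U) :
    (map₂ f hf σ τ).res h = map₂ f hf (σ.res h) (τ.res h) :=
  ext_of_locally (((σ.res h).locally_exists.and (τ.res h).locally_exists
    (fun _ _ _ hW ⟨_, hy⟩ => ⟨_, (σ.res h).res_mem hW hy⟩)
    (fun _ _ _ hW ⟨_, hy⟩ => ⟨_, (τ.res h).res_mem hW hy⟩)).mono
      fun _ hW ⟨⟨_, hx⟩, ⟨_, hy⟩⟩ => ⟨_, ⟨mem_map₂ hx.1 hy.1, hW⟩, mem_map₂ hx hy⟩)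

theorem locally_eq_of_unit_eq {x y : P.obj U} (h : unit x = unit y) :
    Locally U fun _ hV => P.res hV x = P.res hV y :=
  (unit x).locally_eq (mem_unit x) (h ▸ mem_unit y)

/-- Sections of the sheafification that agree locally are equal. -/
theorem eq_of_locally_res_eq {σ τ : ShSection P U}
    (h : Locally U fun _ hV => σ.res hV = τ.res hV) : σ = τ := by
  refine ext_of_locally (h.bind fun V hV e => (σ.res hV).locally_exists.mono fun W hW ⟨x, hx⟩ =>
    ⟨x, hx.1, ?_⟩)
  rw [e] at hx
  exact hx.1

end LocalePresheaf.ShSection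

namespace ConstSection

variable {X : Type v} [Order.Frame X] {U : X} {M : Type u} [AddCommGroup M]

theorem of_add (x y : M) : of U (x + y) = of U x + of U y :=
  ext_of_locally (.of ⟨_, eqOn_of _ le_rfl, (eqOn_of x le_rfl).add (eqOn_of y le_rfl)⟩)

theorem of_neg (x : M) : of U (-x) = -of U x :=
  ext_of_locally (.of ⟨_, eqOn_of _ le_rfl, (eqOn_of x le_rfl).neg⟩)

theorem mapLinear_of {A : Type u} [CommRing A] [Module A M] {N : Type u} [AddCommGroup N]
    [Module A N] (φ : M →ₗ[A] N) (x : M) : mapLinear φ U (of U x) = of U (φ x) :=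
  ext_of_locally (.of ⟨_, (eqOn_of x le_rfl).map φ, eqOn_of _ le_rfl⟩)

end ConstSection

/-! ### Localizations as sections of `M^~` over basic opens -/

namespace LocaleSpec

open ConstSection

variable {A : Type u} [CommRing A] {M : Type u} [AddCommGroup M] [Module A M]
  {N : Type u} [AddCommGroup N] [Module A N]

theorem of_powers_mem_genericFilter {g : A} (s : Submonoid.powers g) :
    of (D g) s.1 ∈ genericFilter (D g) := by
  obtain ⟨n, hn⟩ := s.2
  exact of_mem_genericFilter (hn ▸ D_le_D_pow g n)

theorem awayRes_mk_one {g g' : A} (h : g ∣ g') (m : M) :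
    awayRes h M (LocalizedModule.mk m 1) = LocalizedModule.mk m 1 := by
  rw [awayRes, LocalizedModule.lift_mk]
  simp

namespace tilde

theorem ofAway_mk {g : A} (m : M) (s : Submonoid.powers g) :
    ofAway (LocalizedModule.mk m s) =
      ofFrac (LocalizedModule.mk (of (D g) m) ⟨of (D g) s.1, of_powers_mem_genericFilter s⟩) := by
  rw [ofAway, LocalizedModule.liftOn_mk]

theorem res_ofFrac {U V : LocaleSpec A} (h : V ≤ U) (x : Frac A M U) :
    (tilde A M).res h (ofFrac x) = ofFrac (Frac.res h x) :=
  ShSection.res_unit (P := fracPresheaf A M) h x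

theorem ofAway_zero {g : A} :
    ofAway (0 : LocalizedModule (Submonoid.powers g) M) = zero (D g) := by
  rw [← LocalizedModule.zero_mk 1, ofAway_mk, zero]
  congr 1
  exact LocalizedModule.zero_mk _

theorem ofAway_add {g : A} (x y : LocalizedModule (Submonoid.powers g) M) :
    ofAway (x + y) = add (ofAway x) (ofAway y) := by
  induction x, y using LocalizedModule.induction_on₂ with | _ m m' s s'
  rw [LocalizedModule.mk_add_mk, ofAway_mk, ofAway_mk, ofAway_mk]
  refine Eq.trans ?_ (ShSection.map₂_unit (P := fracPresheaf A M) _ _).symm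
  refine congrArg ofFrac (Eq.trans ?_ LocalizedModule.mk_add_mk.symm)
  congr 1
  · rw [of_add]
    exact congrArg₂ _ (of_smul _ _) (of_smul _ _)
  · exact Subtype.ext (of_mul _ _)

theorem ofAway_neg {g : A} (x : LocalizedModule (Submonoid.powers g) M) :
    ofAway (-x) = neg (ofAway x) := by
  induction x using LocalizedModule.induction_on with | _ m s
  rw [← LocalizedModule.mk_neg, ofAway_mk, ofAway_mk]
  refine Eq.trans ?_ (ShSection.map_unit (P := fracPresheaf A M) _).symm
  refine congrArg ofFrac (Eq.trans ?_ LocalizedModule.mk_neg)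
  rw [of_neg]

theorem ofAway_one {g : A} : ofAway (1 : Localization.Away g) = one (D g) := by
  refine (congrArg (ofAway (M := A)) Localization.mk_one.symm).trans
    ((ofAway_mk (M := A) (g := g) 1 1).trans (congrArg ofFrac ?_))
  exact Localization.mk_one

theorem ofAway_smul {g : A} (x : Localization.Away g)
    (y : LocalizedModule (Submonoid.powers g) M) :
    ofAway (x • y) = smul (A := A) (ofAway x) (ofAway y) := by
  refine LocalizedModule.induction_on (fun a s => ?_) x
  refine LocalizedModule.induction_on (fun m t => ?_) y
  have e : (LocalizedModule.mk a s : Localization.Away g) • LocalizedModule.mk m t =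
    LocalizedModule.mk (a • m) (s * t) := LocalizedModule.mk_smul_mk _ _ _ _
  refine (congrArg ofAway e).trans ?_
  rw [ofAway_mk, ofAway_mk, ofAway_mk]
  refine Eq.trans ?_ (ShSection.map₂_unit (P := fracPresheaf A A) (Q := fracPresheaf A M) _ _).symm
  refine congrArg ofFrac (Eq.trans ?_ (LocalizedModule.mk_smul_mk _ _ _ _).symm)
  congr 1
  · exact of_smul _ _
  · exact Subtype.ext (of_mul _ _)

theorem ofAway_mul {g : A} (x y : Localization.Away g) :
    ofAway (x * y) = mul (A := A) (ofAway x) (ofAway y) := by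
  refine LocalizedModule.induction_on (fun a s => ?_) x
  refine LocalizedModule.induction_on (fun b t => ?_) y
  have e : (LocalizedModule.mk a s * LocalizedModule.mk b t : Localization.Away g) =
    LocalizedModule.mk (a * b) (s * t) := Localization.mk_mul a b s t
  refine (congrArg ofAway e).trans ?_
  rw [ofAway_mk, ofAway_mk, ofAway_mk]
  refine Eq.trans ?_ (ShSection.map₂_unit (P := fracPresheaf A A) (Q := fracPresheaf A A) _ _).symm
  refine congrArg ofFrac (Eq.trans ?_ LocalizedModule.mk_mul_mk.symm)
  congr 1
  · exact of_mul _ _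
  · exact Subtype.ext (of_mul _ _)

theorem ofAway_map {g : A} (φ : M →ₗ[A] N) (x : LocalizedModule (Submonoid.powers g) M) :
    ofAway (IsLocalizedModule.map (Submonoid.powers g)
      (LocalizedModule.mkLinearMap (Submonoid.powers g) M)
      (LocalizedModule.mkLinearMap (Submonoid.powers g) N) φ x) = map φ (ofAway x) := by
  induction x using LocalizedModule.induction_on with | _ m s
  rw [IsLocalizedModule.map_LocalizedModules, ofAway_mk, ofAway_mk]
  refine Eq.trans ?_ (ShSection.map_unit (P := fracPresheaf A M) _).symm
  refine congrArg ofFrac (Eq.trans ?_ (Frac.map_mk _ _ _ _).symm)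
  rw [mapLinear_of]

theorem res_ofAway {g g' : A} (h : g ∣ g') (x : LocalizedModule (Submonoid.powers g) M) :
    (tilde A M).res (D_le_of_dvd h) (ofAway x) = ofAway (awayRes h M x) := by
  induction x using LocalizedModule.induction_on with | _ m s
  -- The image `z` of `m / s` is used only through the equation `s • z = m / 1`. Writing `z = m' /
  -- t`, this equation provides the witness `u` for the equality of fractions of constant sections.
  have hs : s.1 • awayRes h M (LocalizedModule.mk m s) = LocalizedModule.mk m 1 := by
    rw [← map_smul, LocalizedModule.smul'_mk, ← Submonoid.smul_def, LocalizedModule.mk_cancel]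
    exact awayRes_mk_one h m
  generalize awayRes h M (LocalizedModule.mk m s) = z at hs
  induction z using LocalizedModule.induction_on with | _ m' t
  rw [LocalizedModule.smul'_mk, LocalizedModule.mk_eq] at hs
  obtain ⟨u, hu⟩ := hs
  rw [ofAway_mk, res_ofFrac, Frac.res_mk, ofAway_mk]
  refine congrArg ofFrac (LocalizedModule.mk_eq.2
    ⟨⟨of (D g') u.1, of_powers_mem_genericFilter u⟩, ?_⟩)
  simp only [Submonoid.smul_def, res_of, ← of_smul]
  simp only [Submonoid.smul_def, one_smul] at hu
  rw [hu]

/-- Equality of two sections is witnessed locally by elements `a` killing `s' • m - s • m'`, on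
opens contained in `[D(a)]`. Compactness in the form of `mem_radical_of_D_le_sSup`, applied to the
annihilator of this difference, yields a power of `g` that kills it. -/
theorem ofAway_injective {g : A} :
    Function.Injective (ofAway : LocalizedModule (Submonoid.powers g) M → _) := by
  intro x y h
  induction x, y using LocalizedModule.induction_on₂ with | _ m m' s s'
  rw [ofAway_mk, ofAway_mk] at h
  have key : Locally (D g) fun V _ => ∃ a : A, V ≤ D a ∧ a • s' • m = a • s • m' := by
    refine (ShSection.locally_eq_of_unit_eq (P := fracPresheaf A M) h).bind fun V hV e => ?_
    simp only [fracPresheaf] at e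
    rw [Frac.res_mk, Frac.res_mk, LocalizedModule.mk_eq] at e
    obtain ⟨⟨u, hu⟩, e⟩ := e
    -- The denominator `u` is a section of the generic filter; where it is the constant `a`, the
    -- open is contained in `[D(a)]`. Two constants representing the same section agree only
    -- locally, as the open may be empty.
    refine (locally₁ u).bind fun W hW ⟨a, ha⟩ => ?_
    have e₁ : EqOn ((u • of V s'.1 • of V m : ConstSection M V)) W (a • s'.1 • m) :=
      ha.smul ((eqOn_of _ hW).smul (eqOn_of _ hW))
    have e₂ : EqOn ((u • of V s.1 • of V m' : ConstSection M V)) W (a • s.1 • m') :=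
      ha.smul ((eqOn_of _ hW).smul (eqOn_of _ hW))
    have e' : (u • of V s'.1 • of V m : ConstSection M V) = u • of V s.1 • of V m' := by
      simpa only [Submonoid.smul_def, res_of] using e
    rw [e'] at e₁
    exact (e₁.locally_eq e₂).mono fun W' hW' e => ⟨a, hW'.trans (hu a W ha), e⟩
  obtain ⟨n, hn⟩ := mem_radical_of_D_le_sSup
    -- This kernel is the annihilator of the difference. If `D y ≤ D a`, some power of `y` is a
    -- multiple of `a`, so `y` lies in its radical.
    (I := LinearMap.ker (LinearMap.toSpanSingleton A M (s'.1 • m - s.1 • m'))) key (by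
      rintro U ⟨-, a, hU, e⟩ y hy
      obtain ⟨k, b, hk⟩ := exists_pow_eq_mul_of_D_le (hy.trans hU)
      refine ⟨k, ?_⟩
      rw [LinearMap.mem_ker, LinearMap.toSpanSingleton_apply, hk, mul_comm, mul_smul, smul_sub]
      rw [Submonoid.smul_def, Submonoid.smul_def] at e
      rw [e, sub_self, smul_zero])
  rw [LinearMap.mem_ker, LinearMap.toSpanSingleton_apply, smul_sub, sub_eq_zero] at hn
  exact LocalizedModule.mk_eq.2 ⟨⟨g ^ n, n, rfl⟩, hn⟩

/-- Locally a section is a fraction `m' / a` of constants over an open inside `[D(a)]`. On a smaller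
`[D(g)]` one has `g ^ n = a * b`, and so `m' / a = (b • m') / g ^ n`. Quantifying over all `g` with
`D g ≤ V` makes the local property pass to smaller opens at no cost. -/
theorem locally_exists_ofAway {U : LocaleSpec A} (x : (tilde A M).obj U) :
    Locally U fun V hV => ∀ (g : A) (hg : D g ≤ V), ∃ y : LocalizedModule (Submonoid.powers g) M,
      (tilde A M).res (hg.trans hV) x = ofAway y := by
  refine (ShSection.locally_exists (P := fracPresheaf A M) x).bind fun V hV ⟨z, hz⟩ => ?_
  induction z using LocalizedModule.induction_on with | _ m s
  refine (locally₂ m s.1).mono fun W hW ⟨⟨m', hm⟩, ⟨a, ha⟩⟩ g hg => ?_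
  obtain ⟨n, b, hn⟩ := exists_pow_eq_mul_of_D_le (hg.trans (s.2 a W ha))
  refine ⟨LocalizedModule.mk (b • m') ⟨g ^ n, n, rfl⟩, ?_⟩
  rw [ofAway_mk]
  have e : Frac.res (hg.trans hW) (LocalizedModule.mk m s) = LocalizedModule.mk
      (of (D g) (b • m')) ⟨of (D g) (g ^ n), of_powers_mem_genericFilter ⟨g ^ n, n, rfl⟩⟩ := by
    rw [Frac.res_mk, LocalizedModule.mk_eq]
    -- After cross-multiplication both sides are constant on `[D(g)]`, with common value `g ^ n • m'
    -- = a • b • m'`.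
    refine ⟨1, congrArg _ (ConstSection.ext_of_locally (.of ⟨g ^ n • m', ?_, ?_⟩))⟩
    · exact (eqOn_of _ le_rfl).smul ((hm.anti hg).res _ le_rfl)
    · rw [hn, mul_smul]
      exact ((ha.anti hg).res (hg.trans hW) le_rfl).smul (eqOn_of _ le_rfl)
  refine ShSection.ext_of_locally (P := fracPresheaf A M)
    (Locally.of ⟨Frac.res (hg.trans hW) (LocalizedModule.mk m s), ⟨?_, le_rfl⟩, ?_⟩)
  · exact ShSection.res_mem x (hg.trans hW) hz
  · rw [e]
    exact ShSection.mem_unit (P := fracPresheaf A M) _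

end tilde

end LocaleSpec

/-! ### Evaluation of terms -/

open LocaleSpec

theorem valCons_comp {A : Type u} [CommRing A] {val val' : ModuleCat.{u} A → Type w}
    (ρ : ∀ M, val M → val' M) {Γ : List (ModuleCat.{u} A)} {M : ModuleCat.{u} A} (x : val M)
    (γ : ∀ i : Fin Γ.length, val (Γ.get i)) :
    (fun i => ρ _ (valCons (val := val) (M := M) x γ i)) =
      valCons (val := val') (ρ M x) fun i => ρ _ (γ i) := by
  funext i
  induction i using Fin.cases <;> rfl

namespace TildeTerm

variable {A : Type u} [CommRing A] {f : A} {Γ : List (ModuleCat.{u} A)}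

theorem res_sheafEval {U V : LocaleSpec A} (hU : U ≤ D f) (h : V ≤ U)
    (γ : ∀ i : Fin Γ.length, (tilde A (Γ.get i)).obj U) {M : ModuleCat.{u} A}
    (t : TildeTerm f Γ M) : (tilde A M).res h (t.sheafEval hU γ) =
      t.sheafEval (h.trans hU) fun i => (tilde A (Γ.get i)).res h (γ i) := by
  induction t with
  | var i => rfl
  | const x => exact (tilde A _).res_res _ _ _
  | zero => exact (tilde.res_ofFrac h 0).trans (congrArg tilde.ofFrac (by
      rw [← LocalizedModule.zero_mk 1, Frac.res_mk]
      exact (congrArg₂ _ (ConstSection.res_zero h) rfl).trans (LocalizedModule.zero_mk _)))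
  | add s t ihs iht =>
    exact (ShSection.res_map₂ h _ _).trans (congrArg₂ tilde.add ihs iht)
  | neg s ih => exact (ShSection.res_map h _).trans (congrArg tilde.neg ih)
  | one => exact (tilde.res_ofFrac h 1).trans (congrArg tilde.ofFrac (by
      refine (congrArg (Frac.res h) Localization.mk_one.symm).trans ((Frac.res_mk h _ _).trans ?_)
      refine Eq.trans ?_ Localization.mk_one
      exact congrArg₂ _ (ConstSection.res_one h) (Subtype.ext (ConstSection.res_one h))))
  | mul s t ihs iht =>
    exact (ShSection.res_map₂ h _ _).trans (congrArg₂ (tilde.mul (A := A)) ihs iht)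
  | smul s t ihs iht =>
    exact (ShSection.res_map₂ h _ _).trans (congrArg₂ (tilde.smul (A := A)) ihs iht)
  | map φ t ih => exact (ShSection.res_map h _).trans (congrArg (tilde.map φ) ih)

theorem sheafEval_ofAway {g : A} (hg : f ∣ g)
    (γ : ∀ i : Fin Γ.length, LocalizedModule (Submonoid.powers g) (Γ.get i)) {M : ModuleCat.{u} A}
    (t : TildeTerm f Γ M) :
    t.sheafEval (D_le_of_dvd hg) (fun i => tilde.ofAway (γ i)) = tilde.ofAway (t.algEval hg γ) := by
  induction t with
  | var i => rfl
  | const x => exact tilde.res_ofAway hg x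
  | zero => exact tilde.ofAway_zero.symm
  | add s t ihs iht => exact (congrArg₂ tilde.add ihs iht).trans (tilde.ofAway_add _ _).symm
  | neg s ih => exact (congrArg tilde.neg ih).trans (tilde.ofAway_neg _).symm
  | one => exact tilde.ofAway_one.symm
  | mul s t ihs iht =>
    exact (congrArg₂ (tilde.mul (A := A)) ihs iht).trans (tilde.ofAway_mul _ _).symm
  | smul s t ihs iht =>
    exact (congrArg₂ (tilde.smul (A := A)) ihs iht).trans (tilde.ofAway_smul _ _).symm
  | map φ t ih => exact (congrArg (tilde.map φ) ih).trans (tilde.ofAway_map φ _).symm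

end TildeTerm

/-! ### Monotonicity and locality of forcing, and the comparison -/

namespace TildeFormula

variable {A : Type u} [CommRing A] {f : A} {Γ : List (ModuleCat.{u} A)}

theorem sheafForces_or_iff {φ ψ : TildeFormula f Γ} {U : LocaleSpec A} (hU : U ≤ D f)
    (γ : ∀ i : Fin Γ.length, (tilde A (Γ.get i)).obj U) :
    (φ.or ψ).SheafForces U hU γ ↔ Locally U fun V hV =>
      φ.SheafForces V (hV.trans hU) (fun k => (tilde A (Γ.get k)).res hV (γ k)) ∨
      ψ.SheafForces V (hV.trans hU) (fun k => (tilde A (Γ.get k)).res hV (γ k)) := by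
  rw [locally_iff_exists_cover]
  rfl

theorem sheafForces_ex_iff {M : ModuleCat.{u} A} {φ : TildeFormula f (M :: Γ)} {U : LocaleSpec A}
    (hU : U ≤ D f) (γ : ∀ i : Fin Γ.length, (tilde A (Γ.get i)).obj U) :
    (φ.ex M).SheafForces U hU γ ↔ Locally U fun V hV => ∃ x : (tilde A M).obj V,
      φ.SheafForces V (hV.trans hU) (valCons (val := fun M => (tilde A M).obj V) x
        fun k => (tilde A (Γ.get k)).res hV (γ k)) := by
  rw [locally_iff_exists_cover]
  rfl

/-- Implication and universal quantification are monotone by their very clauses; for disjunction and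
existence the covering is intersected with `V`, and the induction hypothesis handles its members. -/
theorem SheafForces.res {φ : TildeFormula f Γ} {U V : LocaleSpec A} {hU : U ≤ D f} (h : V ≤ U)
    {γ : ∀ i : Fin Γ.length, (tilde A (Γ.get i)).obj U} (hφ : φ.SheafForces U hU γ) :
    φ.SheafForces V (h.trans hU) fun k => (tilde A (Γ.get k)).res h (γ k) := by
  induction φ generalizing U V with
  | eq s t =>
    simp only [SheafForces] at hφ ⊢
    rw [← TildeTerm.res_sheafEval hU h, ← TildeTerm.res_sheafEval hU h, hφ]
  | top => trivial
  | bot => exact le_bot_iff.1 (h.trans_eq hφ)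
  | and φ ψ ih₁ ih₂ => exact ⟨ih₁ h hφ.1, ih₂ h hφ.2⟩
  | or φ ψ ih₁ ih₂ =>
    rw [sheafForces_or_iff] at hφ ⊢
    refine (hφ.restrict h fun W W' hW hW' e => ?_).mono fun W hW e => ?_
    · simpa only [LocalePresheaf.res_res] using e.imp (ih₁ hW') (ih₂ hW')
    · simpa only [LocalePresheaf.res_res] using e
  | imp φ ψ ih₁ ih₂ =>
    intro W hW e
    simp only [LocalePresheaf.res_res] at e ⊢
    exact hφ W (hW.trans h) e
  | all M φ ih =>
    intro W hW x
    simp only [LocalePresheaf.res_res]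
    exact hφ W (hW.trans h) x
  | ex M φ ih =>
    rw [sheafForces_ex_iff] at hφ ⊢
    refine (hφ.restrict h fun W W' hW hW' ⟨x, e⟩ => ⟨(tilde A M).res hW' x, ?_⟩).mono
      fun W hW e => ?_
    · have := ih hW' e
      rw [valCons_comp (fun M => (tilde A M).res hW')] at this
      simpa only [LocalePresheaf.res_res] using this
    · simpa only [LocalePresheaf.res_res] using e

/-- Equality is local because sections of a sheafification that agree locally are equal. For
disjunction and existence coverings are composed, so no witnesses need gluing; implication and
universal quantification restrict the covering to `V` and use locality of the subformula. -/
theorem SheafForces.of_locally {φ : TildeFormula f Γ} {U : LocaleSpec A} {hU : U ≤ D f}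
    {γ : ∀ i : Fin Γ.length, (tilde A (Γ.get i)).obj U}
    (hφ : Locally U fun V hV =>
      φ.SheafForces V (hV.trans hU) fun k => (tilde A (Γ.get k)).res hV (γ k)) :
    φ.SheafForces U hU γ := by
  have hres : ∀ {Δ : List (ModuleCat.{u} A)} (χ : TildeFormula f Δ) {U : LocaleSpec A}
      {hU : U ≤ D f} {δ : ∀ i : Fin Δ.length, (tilde A (Δ.get i)).obj U} (W W' : LocaleSpec A)
      (hW : W ≤ U) (hW' : W' ≤ W),
      χ.SheafForces W (hW.trans hU) (fun k => (tilde A (Δ.get k)).res hW (δ k)) →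
      χ.SheafForces W' ((hW'.trans hW).trans hU)
        (fun k => (tilde A (Δ.get k)).res (hW'.trans hW) (δ k)) := by
    intro Δ χ U hU δ W W' hW hW' e
    simpa only [LocalePresheaf.res_res] using e.res hW'
  induction φ generalizing U with
  | eq s t =>
    refine ShSection.eq_of_locally_res_eq (P := fracPresheaf A _) (hφ.mono fun V hV e => ?_)
    exact (s.res_sheafEval hU hV γ).trans (Eq.trans e (t.res_sheafEval hU hV γ).symm)
  | top => trivial
  | bot => exact le_bot_iff.1 (hφ.trans (sSup_le fun V ⟨_, e⟩ => le_of_eq e))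
  | and φ ψ ih₁ ih₂ => exact ⟨ih₁ (hφ.mono fun _ _ e => e.1), ih₂ (hφ.mono fun _ _ e => e.2)⟩
  | or φ ψ ih₁ ih₂ =>
    rw [sheafForces_or_iff]
    refine hφ.bind fun V hV e => ?_
    rw [sheafForces_or_iff] at e
    simpa only [LocalePresheaf.res_res] using e
  | imp φ ψ ih₁ ih₂ =>
    intro V hV e
    refine ih₂ ((hφ.restrict hV (hres (hU := hU) (φ.imp ψ))).mono fun W hW e' => ?_)
    have := e' W le_rfl (by simpa only [LocalePresheaf.res_res] using e.res hW)
    simpa only [LocalePresheaf.res_res] using this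
  | all M φ ih =>
    intro V hV x
    refine ih ((hφ.restrict hV (hres (hU := hU) (φ.all M))).mono fun W hW e' => ?_)
    have := e' W le_rfl ((tilde A M).res hW x)
    rw [valCons_comp (fun M => (tilde A M).res hW)]
    simpa only [LocalePresheaf.res_res] using this
  | ex M φ ih =>
    rw [sheafForces_ex_iff]
    refine hφ.bind fun V hV e => ?_
    rw [sheafForces_ex_iff] at e
    simpa only [LocalePresheaf.res_res] using e

/-- Existential witnesses can be taken from localizations after refining the covering. The
quantifier over `g` again makes the property inherited, as `exists_partition_of_locally` requires.
-/
theorem SheafForces.exists_ofAway {M : ModuleCat.{u} A} {φ : TildeFormula f (M :: Γ)}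
    {U : LocaleSpec A} {hU : U ≤ D f} {γ : ∀ i : Fin Γ.length, (tilde A (Γ.get i)).obj U}
    (h : (φ.ex M).SheafForces U hU γ) : Locally U fun V hV => ∀ (g : A) (hg : D g ≤ V),
      ∃ x : LocalizedModule (Submonoid.powers g) M, φ.SheafForces (D g) ((hg.trans hV).trans hU)
        (valCons (val := fun M => (tilde A M).obj (D g)) (tilde.ofAway x)
          fun k => (tilde A (Γ.get k)).res (hg.trans hV) (γ k)) := by
  rw [sheafForces_ex_iff] at h
  refine h.bind fun V hV ⟨x, e⟩ => (tilde.locally_exists_ofAway x).mono fun W hW hx g hg => ?_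
  obtain ⟨y, hy⟩ := hx g hg
  have := e.res (hg.trans hW)
  rw [valCons_comp (fun M => (tilde A M).res (hg.trans hW)), hy] at this
  exact ⟨y, by simpa only [LocalePresheaf.res_res] using this⟩

/-- On a basic open `[D(g)]`, and for values of the free variables coming from the localizations
away from `g`, the sheaf semantics agrees with the algebraic semantics. -/
theorem sheafForces_iff_algForces (φ : TildeFormula f Γ) {g : A} (hg : f ∣ g)
    (γ : ∀ i : Fin Γ.length, LocalizedModule (Submonoid.powers g) (Γ.get i)) :
    φ.SheafForces (D g) (D_le_of_dvd hg) (fun k => tilde.ofAway (γ k)) ↔ φ.AlgForces g hg γ := by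
  -- `hval` and `hcons` say that valuations coming from localizations remain so after restriction
  -- and after extension by a new variable, which keeps the induction hypotheses applicable.
  have hval : ∀ {Γ : List (ModuleCat.{u} A)} {g : A}
      (γ : ∀ i : Fin Γ.length, LocalizedModule (Submonoid.powers g) (Γ.get i)) (h : A),
      (fun k => (tilde A (Γ.get k)).res (D_mul_le_left g h) (tilde.ofAway (γ k))) =
        fun k => tilde.ofAway (awayRes (Dvd.intro h rfl) (Γ.get k) (γ k)) :=
    fun _ _ => funext fun _ => tilde.res_ofAway _ _
  have hcons : ∀ {Γ : List (ModuleCat.{u} A)} {M : ModuleCat.{u} A} {g : A}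
      (x : LocalizedModule (Submonoid.powers g) M)
      (γ : ∀ i : Fin Γ.length, LocalizedModule (Submonoid.powers g) (Γ.get i)),
      valCons (val := fun M => (tilde A M).obj (D g)) (M := M) (tilde.ofAway x)
        (fun k => tilde.ofAway (γ k)) = fun k => tilde.ofAway
          (valCons (val := fun M => LocalizedModule (Submonoid.powers g) M) (M := M) x γ k) := by
    intro Γ M g x γ
    funext i
    induction i using Fin.cases <;> rfl
  induction φ generalizing g with
  | eq s t =>
    simp only [SheafForces, AlgForces]
    rw [TildeTerm.sheafEval_ofAway, TildeTerm.sheafEval_ofAway]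
    exact tilde.ofAway_injective.eq_iff
  | top => rfl
  | bot => exact D_eq_bot_iff
  | and φ ψ ih₁ ih₂ => exact and_congr (ih₁ hg γ) (ih₂ hg γ)
  | or φ ψ ih₁ ih₂ =>
    rw [sheafForces_or_iff]
    constructor
    · intro h
      obtain ⟨n, m, k, e, h⟩ := exists_partition_of_locally h fun W W' hW hW' e => by
        simpa only [LocalePresheaf.res_res] using
          e.imp (SheafForces.res hW') (SheafForces.res hW')
      refine ⟨n, m, k, e, fun i => ?_⟩
      rw [← propext (ih₁ (hg.mul_right _) _), ← propext (ih₂ (hg.mul_right _) _), ← hval]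
      exact h i
    · rintro ⟨n, m, k, e, h⟩
      refine locally_of_partition e fun i => ?_
      rw [hval, propext (ih₁ (hg.mul_right _) _), propext (ih₂ (hg.mul_right _) _)]
      exact h i
  | imp φ ψ ih₁ ih₂ =>
    constructor
    · intro h k
      rw [← propext (ih₁ (hg.mul_right _) _), ← propext (ih₂ (hg.mul_right _) _), ← hval]
      exact h _ (D_mul_le_left g k)
    · intro h V hV hφ
      -- The open `V` is arbitrary; by locality the conclusion need only be checked on basic opens
      -- `[D(g * k)]` below it, where the algebraic hypothesis applies.
      refine .of_locally (locally_of_forall_D hV fun k hk => ?_)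
      have e := hφ.res hk
      simp only [LocalePresheaf.res_res] at e ⊢
      have e' := h k
      rw [← propext (ih₁ (hg.mul_right _) _), ← propext (ih₂ (hg.mul_right _) _), ← hval] at e'
      exact e' e
  | all M φ ih =>
    constructor
    · intro h k x
      rw [← propext (ih (hg.mul_right _) _), ← hcons, ← hval]
      exact h _ (D_mul_le_left g k) _
    · intro h V hV x
      -- Here the section `x` is arbitrary too: the covering is refined until `x` comes from an
      -- element `y` of `M[(g * k)⁻¹]`.
      refine .of_locally ((tilde.locally_exists_ofAway x).bind fun W hW hx =>
        locally_of_forall_D (hW.trans hV) fun k hk => ?_)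
      obtain ⟨y, hy⟩ := hx _ hk
      rw [valCons_comp (fun M => (tilde A M).res (hk.trans hW)), hy]
      have e := h k y
      rw [← propext (ih (hg.mul_right _) _), ← hcons, ← hval] at e
      simpa only [LocalePresheaf.res_res] using e
  | ex M φ ih =>
    constructor
    · intro h
      obtain ⟨n, m, k, e, h⟩ := exists_partition_of_locally h.exists_ofAway
        fun W W' hW hW' e g' hg' => e g' (hg'.trans hW')
      refine ⟨n, m, k, e, fun i => ?_⟩
      -- The inherited property is now used at the member `[D(g * k i)]` of the partition itself.
      obtain ⟨x, hx⟩ := h i _ le_rfl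
      refine ⟨x, ?_⟩
      rw [← propext (ih (hg.mul_right _) _), ← hcons, ← hval]
      exact hx
    · rintro ⟨n, m, k, e, h⟩
      rw [sheafForces_ex_iff]
      refine locally_of_partition e fun i => ?_
      obtain ⟨x, hx⟩ := h i
      refine ⟨tilde.ofAway x, ?_⟩
      rw [hval, hcons, propext (ih (hg.mul_right _) _)]
      exact hx

end TildeFormula

theorem mainTheorem6 {A : Type u} [CommRing A] (f : A) (φ : TildeFormula f []) :
    φ.SheafForces (LocaleSpec.D f) le_rfl (fun i => i.elim0) ↔
      φ.AlgForces f dvd_rfl (fun i => i.elim0) := by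
  rw [← φ.sheafForces_iff_algForces]
  -- Without free variables the two valuations are functions on an empty type, hence equal.
  exact iff_of_eq (congrArg _ (funext fun i => i.elim0))
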